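/- Let $G$ be a finite-dimensional Lie group with Lie algebra $\mathfrak g$, let $\langle\cdot,\cdot\rangle$ be a positive-definite inner product on $\mathfrak g$ that is bi-invariant, i.e. $\langle \mathrm{ad}_u v,w\rangle+\langle v,\mathrm{ad}_u w\rangle=0$ for all $u,v,w\in\mathfrak g$, let $H$ be a Lie subgroup of $G$ with Lie algebra $\mathfrak h\subseteq\mathfrak g$, and let $P$ be the $\langle\cdot,\cdot\rangle$-orthogonal projection of $\mathfrak g$ onto $\mathfrak h$. Let $\delta>-1$, put $\Lambda=I+\delta P$, and equip $G$ with the left-invariant Riemannian metric $g$ (the Cheeger deformation along $H$) given on $\mathfrak g$ by $$g(u,v)=\langle u,\Lambda v\rangle=\langle u,v\rangle+\delta\langle Pu,Pv\rangle .$$ Let $p_0\in\mathfrak h$, $q_0\in\mathfrak h^{\perp}$ and $u_0=p_0+q_0$. Then the curve $$\gamma(t)=\exp(t\Lambda u_0)\,\exp(-\delta t p_0),\qquad t\in\mathbb R,$$ where $\exp$ is the Lie group exponential map, is a geodesic of $(G,g)$ with $\gamma(0)=\mathrm{id}$ and $\gamma'(0)=u_0$. Conversely, every geodesic $\gamma$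 of $(G,g)$ that is defined on a nondegenerate interval $S\ni 0$ and satisfies $\gamma(0)=\mathrm{id}$, $\gamma'(0)=u_0$ is given by this formula for all $t\in S$, and its left-translated velocity is $$\gamma(t)^{-1}\gamma'(t)=p_0+\mathrm{Ad}_{\exp(\delta t p_0)}\,q_0,\qquad t\in S .$$ -/

import Mathlib

open Set Manifold
open scoped ContDiff Manifold

noncomputable section LieGroupGeometry

section Riemannian

variable {E : Type*} [NormedAddCommGroup E] [NormedSpace ℝ E]
  {H : Type*} [TopologicalSpace H] (I : ModelWithCorners ℝ E H)
  {M : Type*} [TopologicalSpace M] [ChartedSpace H M]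

/-- The components of a metric tensor `g` in the chart of `M` centred at `p`: the value at the
point with coordinates `y` on the coordinate vectors `v` and `w`. -/
def chartMetric (g : (x : M) → LinearMap.BilinForm ℝ (TangentSpace I x)) (p : M) (y v w : E) : ℝ :=
  g ((extChartAt I p).symm y)
    (mfderiv 𝓘(ℝ, E) I (extChartAt I p).symm y v) (mfderiv 𝓘(ℝ, E) I (extChartAt I p).symm y w)

/-- The Christoffel symbols of the first kind of the Levi-Civita connection of `g` in the chart
centred at `p`: `Γ(u, v; w) = ½ (∂_u g(v, w) + ∂_v g(u, w) - ∂_w g(u, v))` for constant coordinate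
vectors `u`, `v`, `w`. -/
def christoffel (g : (x : M) → LinearMap.BilinForm ℝ (TangentSpace I x)) (p : M)
    (y u v w : E) : ℝ :=
  (fderiv ℝ (fun z => chartMetric I g p z v w) y u
    + fderiv ℝ (fun z => chartMetric I g p z u w) y v
    - fderiv ℝ (fun z => chartMetric I g p z u v) y w) / 2

/-- A curve `γ`, defined on an interval `S`, is a geodesic of the Riemannian metric `g`: it is
twice continuously differentiable and satisfies `∇_{γ'} γ' = 0` for the Levi-Civita connection.
In coordinates `x` this is `g(x'', w) + Γ(x', x'; w) = 0` for all `w`. The equation does not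
depend on the coordinates, and at time `t` it is written in the chart centred at `γ t`. -/
def IsGeodesicOn (g : (x : M) → LinearMap.BilinForm ℝ (TangentSpace I x)) (γ : ℝ → M)
    (S : Set ℝ) : Prop :=
  ContMDiffOn 𝓘(ℝ, ℝ) I 2 γ S ∧
  ∀ t ∈ S,
    let x : ℝ → E := fun s => extChartAt I (γ t) (γ s)
    let x' : ℝ → E := derivWithin x S
    let x'' : ℝ → E := derivWithin x' S
    ∀ w : E, chartMetric I g (γ t) (x t) (x'' t) w
      + christoffel I g (γ t) (x t) (x' t) (x' t) w = 0

end Riemannian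

variable {E : Type*} [NormedAddCommGroup E] [NormedSpace ℝ E] [FiniteDimensional ℝ E]
  {H : Type*} [TopologicalSpace H] (I : ModelWithCorners ℝ E H)
  {G : Type*} [TopologicalSpace G] [ChartedSpace H G] [Group G]

section Group

/-- Left translation of a tangent vector at `x` to the Lie algebra, `v ↦ x⁻¹ v`. -/
def leftTranslate (x : G) : TangentSpace I x →ₗ[ℝ] GroupLieAlgebra I G :=
  (mfderiv I I (fun y : G => x⁻¹ * y) x).toLinearMap

/-- The adjoint action `Ad_x v = x v x⁻¹` of the group on its Lie algebra. -/
def adjointAction (x : G) : GroupLieAlgebra I G →ₗ[ℝ] GroupLieAlgebra I G :=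
  (mfderiv I I (fun y : G => x * y * x⁻¹) 1).toLinearMap

/-- The left-invariant metric tensor with value `b` on the Lie algebra. -/
def leftInvariantMetric (b : LinearMap.BilinForm ℝ (GroupLieAlgebra I G)) (x : G) :
    LinearMap.BilinForm ℝ (TangentSpace I x) :=
  b.comp (leftTranslate I x) (leftTranslate I x)

/-- Every element of the Lie algebra generates a one-parameter subgroup: the integral curve through
the identity of its left-invariant vector field exists for all times. -/
theorem exists_oneParameterSubgroup [I.Boundaryless] [T2Space G] [LieGroup I ∞ G]
    (v : GroupLieAlgebra I G) :
    ∃ φ : ℝ → G, φ 0 = 1 ∧ IsMIntegralCurve (I := I) φ (mulInvariantVectorField v) := by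
  have : CompleteSpace E := FiniteDimensional.complete ℝ E
  have h3 : LieGroup I (minSmoothness ℝ 3) G := LieGroup.of_le (n := ∞)
    (by rw [minSmoothness_of_isRCLikeNormedField]; exact ENat.LEInfty.out)
  have hI : IsManifold I ∞ G := inferInstance
  have hI1 : IsManifold I 1 G := IsManifold.of_le (n := ∞) (by simp)
  have hv : ContMDiff I I.tangent 1
      (fun g : G => (⟨g, mulInvariantVectorField v g⟩ : TangentBundle I G)) :=
    (contMDiff_mulInvariantVectorField v).of_le (by simp)
  have hmul : ∀ g : G, MDifferentiable I I (fun x : G => g * x) := fun g =>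
    (contMDiff_mul_left (I := I) (n := ∞)).mdifferentiable (by simp)
  obtain ⟨c, hc0, hc⟩ := exists_isMIntegralCurveAt_of_contMDiffAt_boundaryless (I := I) 0
    (hv.contMDiffAt (x := 1))
  obtain ⟨ε, hε, hc⟩ := isMIntegralCurveAt_iff'.1 hc
  refine exists_isMIntegralCurve_of_isMIntegralCurveOn hv hε (fun x => ?_) 1
  refine ⟨fun t => x * c t, by simp [hc0], fun t ht => ?_⟩
  have h := hc t (by simpa [Real.ball_eq_Ioo] using ht)
  have hcomp := ((hmul x) (c t)).hasMFDerivAt.comp_hasMFDerivWithinAt t h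
  have hs : Metric.ball (0 : ℝ) ε = Ioo (-ε) ε := by simp [Real.ball_eq_Ioo]
  rw [hs] at hcomp
  have hd : (fun y : G => x * c t * y) = (fun y => x * y) ∘ (fun y => c t * y) := by
    funext y; simp [mul_assoc]
  have hfield : mulInvariantVectorField v (x * c t)
      = mfderiv I I (fun y : G => x * y) (c t) (mulInvariantVectorField v (c t)) := by
    have h1 := mfderiv_comp_apply_of_eq (1 : G) (hmul x (c t)) (hmul (c t) 1) (mul_one _) v
    rw [← hd] at h1
    exact h1
  refine hcomp.congr_mfderiv ?_
  ext
  have h2 := hfield.symm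
  change mfderiv I I (fun y : G => x * y) (c t) ((1 : ℝ) • mulInvariantVectorField v (c t))
    = (1 : ℝ) • mulInvariantVectorField v (x * c t)
  rw [one_smul, one_smul, h2]

/-- The exponential map of the Lie group: `exp v = φ 1`, for the one-parameter subgroup `φ`
with initial velocity `v`. -/
def lieExp [I.Boundaryless] [T2Space G] [LieGroup I ∞ G] (v : GroupLieAlgebra I G) : G :=
  (exists_oneParameterSubgroup I v).choose 1

end Group

section BergerCheeger

variable (G) in
/-- A positive-definite bi-invariant metric on the group, given by its value on the Lie algebra. -/
structure BiInvariantMetric where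
  form : LinearMap.BilinForm ℝ (GroupLieAlgebra I G)
  symm : ∀ u v, form u v = form v u
  pos : ∀ u, u ≠ 0 → 0 < form u u
  adInvariant : ∀ u v w : GroupLieAlgebra I G, form ⁅u, v⁆ w + form v ⁅u, w⁆ = 0

variable {F : Type*} [NormedAddCommGroup F] [NormedSpace ℝ F]
  {N : Type*} [TopologicalSpace N] (J : ModelWithCorners ℝ F N)
  {K : Type*} [TopologicalSpace K] [ChartedSpace N K] [Group K]

/-- The Lie algebra, as a subspace of that of `G`, of the Lie subgroup with inclusion `ι`. -/
def subgroupLieAlgebra (ι : K →* G) : Submodule ℝ (GroupLieAlgebra I G) :=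
  LinearMap.range ((mfderiv J I ι 1).toLinearMap : GroupLieAlgebra J K →ₗ[ℝ] E)

variable {I}

namespace BiInvariantMetric

variable (B : BiInvariantMetric I G) (𝔥 : Submodule ℝ (GroupLieAlgebra I G))

/-- The orthogonal complement of a subspace of the Lie algebra. -/
def perp : Submodule ℝ (GroupLieAlgebra I G) := B.form.orthogonal 𝔥

theorem isCompl_perp : IsCompl 𝔥 (B.perp 𝔥) := by
  have : FiniteDimensional ℝ (GroupLieAlgebra I G) := inferInstanceAs (FiniteDimensional ℝ E)
  refine (LinearMap.BilinForm.isCompl_orthogonal_iff_disjoint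
    (fun u v h => by rw [B.symm, h])).2 (Submodule.disjoint_def.2 fun u hu hu' => ?_)
  by_contra h0
  exact (B.pos u h0).ne' (hu' u hu)

/-- The orthogonal projection onto a subspace of the Lie algebra. -/
def proj : GroupLieAlgebra I G →ₗ[ℝ] GroupLieAlgebra I G :=
  Submodule.projection 𝔥 (B.perp 𝔥) (B.isCompl_perp 𝔥)

/-- The operator `Λ = 1 + δ P`, where `P` is the orthogonal projection. -/
def Lam (δ : ℝ) : GroupLieAlgebra I G →ₗ[ℝ] GroupLieAlgebra I G :=
  LinearMap.id + δ • B.proj 𝔥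

/-- The Cheeger deformation `g(u, v) = ⟨u, v⟩ + δ ⟨P u, P v⟩`, on the Lie algebra. -/
def cheegerForm (δ : ℝ) : LinearMap.BilinForm ℝ (GroupLieAlgebra I G) :=
  B.form + δ • B.form.comp (B.proj 𝔥) (B.proj 𝔥)

end BiInvariantMetric

end BergerCheeger

end LieGroupGeometry

/-!
The motion of a curve `γ` in `G` is described by its left-translated velocity `u = γ⁻¹ γ'`, the
left logarithmic derivative of `γ`, which is the pullback of the Maurer–Cartan form `θ`. Two curves
with the same velocity and a common point coincide (`eqOn_of_hasLogDerivWithinAt`), so it is enough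
to determine `u`.

By the Maurer–Cartan equation `dθ(a, b) = -[θ a, θ b]` (`fderiv_leftLogDeriv_sub`), the Christoffel
symbols of a left-invariant metric with value `β` on the Lie algebra only involve the symmetric part
of the derivative of `θ` and the bracket. A curve is therefore a geodesic if and only if its
velocity satisfies the Euler–Arnold equation `β(u', w) = β(u, [u, w])` for all `w`
(`isGeodesicOn_leftInvariantMetric_iff`).

For the Cheeger deformation `β(u, v) = ⟨u, v⟩ + δ ⟨P u, P v⟩` of a bi-invariant form this equation
says that `u + δ P u` has the derivative `δ [P u, u]`. Here `ad_{P u}` is skew-symmetric and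
preserves the subalgebra `𝔥`, hence commutes with `P`, and so `P [P u, u] = [P u, P u] = 0`. As
`1 + δ ≠ 0`, the equation becomes `u' = δ [P u, u]` (`eulerArnold_cheeger_iff`). Consequently `P u`
is constant, equal to `p₀`, and what is left is the linear equation `u' = δ [p₀, u]`, whose solution
is `Ad_{exp(δ t p₀)} u₀ = p₀ + Ad_{exp(δ t p₀)} q₀`, since
`d/ds Ad_{exp(s v)} w = [v, Ad_{exp(s v)} w]` (`hasDerivAt_adjointCLM_expCurve`).
By the product rule this is the velocity of `exp(t (u₀ + δ p₀)) exp(-δ t p₀)`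
(`hasLogDerivWithinAt_expCurve_mul`), and `u₀ + δ p₀ = Λ u₀`.

That `𝔥` is closed under the bracket comes from its being the image of the Lie algebra of the
subgroup under the derivative of a homomorphism (`bracketCLM_map`).

Tangent vectors at the identity are elements of the model space `E`, and the Lie algebra
`GroupLieAlgebra I G` is `E` by definition. The computations are made in `E`: left logarithmic
derivatives are read in the chart centred at the identity, and the bracket is the continuous
bilinear map `bracketCLM`.
-/

open Filter Topology

/-! ### Left logarithmic derivatives -/

section LogDeriv

variable {E : Type*} [NormedAddCommGroup E] [NormedSpace ℝ E]
  {H : Type*} [TopologicalSpace H] (I : ModelWithCorners ℝ E H)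
  {G : Type*} [TopologicalSpace G] [ChartedSpace H G] [Group G]
  {X : Type*} [NormedAddCommGroup X] [NormedSpace ℝ X]
  {Y : Type*} [NormedAddCommGroup Y] [NormedSpace ℝ Y]

/-- The map `f` into the group has the left logarithmic derivative `A` at `x` within `S`: this is
the derivative at `z = x` of `f(x)⁻¹ f(z)`, read in the chart centred at the identity. -/
def HasLogDerivWithinAt (f : X → G) (A : X →L[ℝ] E) (S : Set X) (x : X) : Prop :=
  ContinuousWithinAt f S x ∧
    HasFDerivWithinAt (fun z => extChartAt I (1 : G) ((f x)⁻¹ * f z)) A S x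

/-- The left logarithmic derivative of a map `f` into the group, that is, the pullback under `f`
of the Maurer–Cartan form. -/
noncomputable def leftLogDeriv (f : X → G) (x : X) : X →L[ℝ] E :=
  fderiv ℝ (fun z => extChartAt I (1 : G) ((f x)⁻¹ * f z)) x

variable {I}

theorem HasLogDerivWithinAt.leftLogDeriv_eq {f : X → G} {A : X →L[ℝ] E} {x : X}
    (h : HasLogDerivWithinAt I f A univ x) : leftLogDeriv I f x = A :=
  (hasFDerivWithinAt_univ.1 h.2).fderiv

theorem HasLogDerivWithinAt.mono {f : X → G} {A : X →L[ℝ] E} {S T : Set X} {x : X}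
    (h : HasLogDerivWithinAt I f A S x) (hT : T ⊆ S) : HasLogDerivWithinAt I f A T x :=
  ⟨h.1.mono hT, h.2.mono hT⟩

theorem HasLogDerivWithinAt.unique {f : X → G} {A A' : X →L[ℝ] E} {S : Set X} {x : X}
    (h : HasLogDerivWithinAt I f A S x) (h' : HasLogDerivWithinAt I f A' S x)
    (hS : UniqueDiffWithinAt ℝ S x) : A = A' :=
  hS.eq h.2 h'.2

theorem HasLogDerivWithinAt.comp {f : X → G} {A : X →L[ℝ] E} {S : Set X} {h : Y → X}
    {h' : Y →L[ℝ] X} {T : Set Y} (y : Y) (hf : HasLogDerivWithinAt I f A S (h y))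
    (hh : HasFDerivWithinAt h h' T y) (hT : MapsTo h T S) :
    HasLogDerivWithinAt I (fun z => f (h z)) (A.comp h') T y :=
  ⟨hf.1.comp hh.continuousWithinAt hT, hf.2.comp y hh hT⟩

theorem HasLogDerivWithinAt.const_mul {f : X → G} {A : X →L[ℝ] E} {S : Set X} {x : X}
    [ContinuousMul G] (h : HasLogDerivWithinAt I f A S x) (g : G) :
    HasLogDerivWithinAt I (fun z => g * f z) A S x := by
  refine ⟨continuousWithinAt_const.mul h.1, ?_⟩
  have : (fun z => extChartAt I (1 : G) ((g * f x)⁻¹ * (g * f z)))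
      = fun z => extChartAt I (1 : G) ((f x)⁻¹ * f z) := by
    funext z; congr 1; group
  rw [this]; exact h.2

theorem hasLogDerivWithinAt_of_hasMFDerivWithinAt [LieGroup I ∞ G] {f : X → G} {S : Set X} {x : X}
    {f' : X →L[ℝ] E} (h : HasMFDerivWithinAt 𝓘(ℝ, X) I f S x f') :
    HasLogDerivWithinAt I f
      ((mfderiv I I (fun y : G => (f x)⁻¹ * y) (f x) : E →L[ℝ] E).comp f') S x := by
  have hm : MDifferentiableAt I I (fun y : G => (f x)⁻¹ * y) (f x) :=
    (contMDiff_mul_left (I := I) (n := ∞)).mdifferentiable (by simp) _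
  have h1 := hm.hasMFDerivAt.comp_hasMFDerivWithinAt x h
  refine ⟨h.continuousWithinAt, ?_⟩
  have h2 : HasFDerivWithinAt (fun z => extChartAt I ((f x)⁻¹ * f x) ((f x)⁻¹ * f z))
    ((mfderiv I I (fun y : G => (f x)⁻¹ * y) (f x) : E →L[ℝ] E).comp f')
    (id ⁻¹' S ∩ range id) x := h1.2
  have hs : id ⁻¹' S ∩ range id = S := by simp
  rw [inv_mul_cancel, hs] at h2
  exact h2

/-- The left logarithmic derivative is the left translate of the derivative. -/
theorem leftTranslate_mfderivWithin [FiniteDimensional ℝ E] [LieGroup I ∞ G] {f : X → G}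
    {S : Set X} {x : X} {A : X →L[ℝ] E}
    (hf : MDifferentiableWithinAt 𝓘(ℝ, X) I f S x) (h : HasLogDerivWithinAt I f A S x)
    (hS : UniqueDiffWithinAt ℝ S x) (v : X) :
    leftTranslate I (f x) (mfderivWithin 𝓘(ℝ, X) I f S x v) = A v := by
  have h1 := hasLogDerivWithinAt_of_hasMFDerivWithinAt hf.hasMFDerivWithinAt
  rw [h.unique h1 hS]
  rfl

theorem hasLogDerivWithinAt_of_mdifferentiableWithinAt [LieGroup I ∞ G] {f : X → G}
    {S : Set X} {x : X} (hf : MDifferentiableWithinAt 𝓘(ℝ, X) I f S x) :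
    ∃ A, HasLogDerivWithinAt I f A S x :=
  ⟨_, hasLogDerivWithinAt_of_hasMFDerivWithinAt hf.hasMFDerivWithinAt⟩

end LogDeriv

/-! ### The product rule and uniqueness for left logarithmic derivatives -/

section LogDerivRules

variable {E : Type*} [NormedAddCommGroup E] [NormedSpace ℝ E]
  {H : Type*} [TopologicalSpace H] {I : ModelWithCorners ℝ E H}
  {G : Type*} [TopologicalSpace G] [ChartedSpace H G] [Group G]
  {X : Type*} [NormedAddCommGroup X] [NormedSpace ℝ X]

variable (I G) in
/-- The inverse of the chart centred at the identity. -/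
noncomputable def chartExp (y : E) : G := (extChartAt I (1 : G)).symm y

variable (I G) in
/-- The coordinates of the identity in the chart centred there. -/
noncomputable def chartOrigin : E := extChartAt I (1 : G) 1

theorem chartExp_origin : chartExp I G (chartOrigin I G) = 1 := extChartAt_to_inv (I := I) (1 : G)

theorem chartExp_extChartAt_eventually :
    ∀ᶠ x in 𝓝 (1 : G), chartExp I G (extChartAt I (1 : G) x) = x := by
  filter_upwards [extChartAt_source_mem_nhds (I := I) (1 : G)] with x hx
  exact (extChartAt I (1 : G)).left_inv hx

theorem extChartAt_inv_mul_self {X : Type*} (f : X → G) (x : X) :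
    extChartAt I (1 : G) ((f x)⁻¹ * f x) = chartOrigin I G := by
  rw [inv_mul_cancel]; rfl

theorem tendsto_inv_mul_nhds_one {X : Type*} [TopologicalSpace X] [IsTopologicalGroup G]
    {f : X → G} {S : Set X} {x : X}
    (h : ContinuousWithinAt f S x) : Tendsto (fun z => (f x)⁻¹ * f z) (𝓝[S] x) (𝓝 1) := by
  have h1 : ContinuousWithinAt (fun z => (f x)⁻¹ * f z) S x := continuousWithinAt_const.mul h
  simpa [ContinuousWithinAt] using h1

variable (I) in
/-- The adjoint action, as a continuous linear map of the model space. -/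
noncomputable def adjointCLM (g : G) : E →L[ℝ] E := mfderiv I I (fun y : G => g * y * g⁻¹) 1

theorem mdifferentiableAt_conj [LieGroup I ∞ G] (g h : G) :
    MDifferentiableAt I I (fun y : G => g * y * g⁻¹) h :=
  (((contMDiff_mul_left (I := I) (n := ∞) (a := g)).mul contMDiff_const).mdifferentiable
    (by simp)) _

variable [I.Boundaryless]

theorem extChartAt_chartExp_eventually :
    ∀ᶠ y in 𝓝 (chartOrigin I G), extChartAt I (1 : G) (chartExp I G y) = y := by
  filter_upwards [extChartAt_target_mem_nhds (I := I) (1 : G)] with y hy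
  exact (extChartAt I (1 : G)).right_inv hy

theorem contMDiffAt_chartExp [IsManifold I ∞ G] :
    ContMDiffAt 𝓘(ℝ, E) I 2 (chartExp I G) (chartOrigin I G) :=
  (contMDiffOn_extChartAt_symm (I := I) (1 : G)).contMDiffAt
    (extChartAt_target_mem_nhds (I := I) (1 : G))

/-- The derivative at the identity of a map into the group, read in the chart there. -/
theorem hasFDerivAt_comp_chartExp {E' : Type*} [NormedAddCommGroup E'] [NormedSpace ℝ E']
    {H' : Type*} [TopologicalSpace H'] {I' : ModelWithCorners ℝ E' H'}
    {G' : Type*} [TopologicalSpace G'] [ChartedSpace H' G'] [Group G'] {c : G → G'}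
    {c' : E →L[ℝ] E'} (h : HasMFDerivAt I I' c (1 : G) c') (hc : c 1 = 1) :
    HasFDerivAt (fun y => extChartAt I' (1 : G') (c (chartExp I G y))) c' (chartOrigin I G) := by
  have h2 : HasFDerivWithinAt (fun y => extChartAt I' (c 1) (c (chartExp I G y))) c'
    (range I) (chartOrigin I G) := h.2
  rwa [hc, I.range_eq_univ, hasFDerivWithinAt_univ] at h2

variable [LieGroup I ∞ G]

theorem hasFDerivAt_conj_chartExp (g : G) :
    HasFDerivAt (fun y => extChartAt I (1 : G) (g * chartExp I G y * g⁻¹)) (adjointCLM I g)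
      (chartOrigin I G) :=
  hasFDerivAt_comp_chartExp (mdifferentiableAt_conj g 1).hasMFDerivAt (by simp)

theorem adjointCLM_one : adjointCLM I (1 : G) = ContinuousLinearMap.id ℝ E := by
  refine (hasFDerivAt_conj_chartExp (I := I) (1 : G)).unique ?_
  refine (hasFDerivAt_id _).congr_of_eventuallyEq ?_
  filter_upwards [extChartAt_chartExp_eventually (I := I) (G := G)] with y hy
  simpa using hy

/-- The product rule for left logarithmic derivatives. -/
theorem HasLogDerivWithinAt.mul {f g : X → G} {A B : X →L[ℝ] E} {S : Set X} {x : X}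
    (hf : HasLogDerivWithinAt I f A S x) (hg : HasLogDerivWithinAt I g B S x) :
    HasLogDerivWithinAt I (fun z => f z * g z) ((adjointCLM I (g x)⁻¹).comp A + B) S x := by
  have : IsTopologicalGroup G := topologicalGroup_of_lieGroup I ∞
  refine ⟨hf.1.mul hg.1, ?_⟩
  set k := (g x)⁻¹ with hk
  set o := chartOrigin I G
  -- Since `(f(x) g(x))⁻¹ f(z) g(z) = k (f(x)⁻¹ f(z)) k⁻¹ (g(x)⁻¹ g(z))`, the multiplication is
  -- read in the chart at the identity after conjugating the first factor by `k = g(x)⁻¹`.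
  let μ : E × E → E := fun p => extChartAt I (1 : G) (k * chartExp I G p.1 * k⁻¹ * chartExp I G p.2)
  have hμ : ContDiffAt ℝ 2 μ (o, o) := by
    rw [← contMDiffAt_iff_contDiffAt]
    have h1 : ContMDiffAt 𝓘(ℝ, E × E) I 2 (fun p : E × E => chartExp I G p.1) (o, o) :=
      ContMDiffAt.comp (o, o) (contMDiffAt_chartExp (I := I) (G := G))
        (contMDiffAt_iff_contDiffAt.2 contDiffAt_fst)
    have h2 : ContMDiffAt 𝓘(ℝ, E × E) I 2 (fun p : E × E => chartExp I G p.2) (o, o) :=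
      ContMDiffAt.comp (o, o) (contMDiffAt_chartExp (I := I) (G := G))
        (contMDiffAt_iff_contDiffAt.2 contDiffAt_snd)
    have h3 := ((contMDiffAt_const (c := k)).mul h1).mul (contMDiffAt_const (c := k⁻¹)) |>.mul h2
    refine (contMDiffAt_extChartAt (x := (1 : G))).comp_of_eq h3 ?_
    simp [o, chartExp_origin]
  obtain ⟨D, hD⟩ : ∃ D, HasFDerivAt μ D (o, o) := ⟨_, (hμ.differentiableAt (by simp)).hasFDerivAt⟩
  have hD1 : D.comp (ContinuousLinearMap.inl ℝ E E) = adjointCLM I k := by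
    have h1 : HasFDerivAt (fun y => μ (y, o)) (D.comp (ContinuousLinearMap.inl ℝ E E)) o :=
      HasFDerivAt.comp (g := μ) (f := fun y => (y, o)) o hD
        (hasFDerivAt_prodMk_left o o)
    refine h1.unique ?_
    have h2 : (fun y => μ (y, o)) = fun y => extChartAt I (1 : G) (k * chartExp I G y * k⁻¹) := by
      funext y; simp [μ, o, chartExp_origin]
    rw [h2]
    exact hasFDerivAt_conj_chartExp k
  have hD2 : D.comp (ContinuousLinearMap.inr ℝ E E) = ContinuousLinearMap.id ℝ E := by
    have h1 : HasFDerivAt (fun y => μ (o, y)) (D.comp (ContinuousLinearMap.inr ℝ E E)) o :=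
      HasFDerivAt.comp (g := μ) (f := fun y => (o, y)) o hD
        (hasFDerivAt_prodMk_right o o)
    refine h1.unique ((hasFDerivAt_id _).congr_of_eventuallyEq ?_)
    filter_upwards [extChartAt_chartExp_eventually (I := I) (G := G)] with y hy
    simpa [μ, o, chartExp_origin] using hy
  have hD' : D.comp (A.prod B) = (adjointCLM I k).comp A + B := by
    ext v
    have h1 := congrArg (fun T => T (A v)) hD1
    have h2 := congrArg (fun T => T (B v)) hD2
    have h3 : D (A v, B v) = D (A v, 0) + D (0, B v) := by rw [← map_add]; simp
    simp only [ContinuousLinearMap.comp_apply, ContinuousLinearMap.inl_apply,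
      ContinuousLinearMap.inr_apply, ContinuousLinearMap.id_apply] at h1 h2
    simp [h3, h1, h2]
  rw [← hD']
  have hfg := hf.2.prodMk hg.2
  have hD3 : HasFDerivAt μ D (extChartAt I (1 : G) ((f x)⁻¹ * f x),
      extChartAt I (1 : G) ((g x)⁻¹ * g x)) := by
    rw [extChartAt_inv_mul_self, extChartAt_inv_mul_self]; exact hD
  have hev : ∀ z, chartExp I G (extChartAt I (1 : G) ((f x)⁻¹ * f z)) = (f x)⁻¹ * f z →
      chartExp I G (extChartAt I (1 : G) ((g x)⁻¹ * g z)) = (g x)⁻¹ * g z →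
      extChartAt I (1 : G) ((f x * g x)⁻¹ * (f z * g z))
        = μ (extChartAt I (1 : G) ((f x)⁻¹ * f z), extChartAt I (1 : G) ((g x)⁻¹ * g z)) := by
    intro z h1 h2
    simp only [μ]
    rw [h1, h2, hk]
    congr 1; group
  refine (hD3.comp_hasFDerivWithinAt x hfg).congr_of_eventuallyEq ?_ ?_
  · filter_upwards [(tendsto_inv_mul_nhds_one hf.1).eventually
      (chartExp_extChartAt_eventually (I := I)), (tendsto_inv_mul_nhds_one hg.1).eventually
      (chartExp_extChartAt_eventually (I := I))] with z h1 h2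
    exact hev z h1 h2
  · refine hev x ?_ ?_ <;> rw [extChartAt_inv_mul_self, chartExp_origin, inv_mul_cancel]

/-- The quotient `f g⁻¹` of two maps with the same left logarithmic derivative has zero left
logarithmic derivative. -/
theorem HasLogDerivWithinAt.mul_inv_eq_zero {f g : X → G} {A : X →L[ℝ] E} {S : Set X} {x : X}
    (hf : HasLogDerivWithinAt I f A S x) (hg : HasLogDerivWithinAt I g A S x) :
    HasLogDerivWithinAt I (fun z => f z * (g z)⁻¹) 0 S x := by
  have : IsTopologicalGroup G := topologicalGroup_of_lieGroup I ∞
  refine ⟨hf.1.mul hg.1.inv, ?_⟩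
  set k := g x with hk
  set o := chartOrigin I G
  -- The map to differentiate is `k (f(x)⁻¹ f(z)) (g(x)⁻¹ g(z))⁻¹ k⁻¹`, with `k = g(x)`.
  let μ : E × E → E := fun p =>
    extChartAt I (1 : G) (k * (chartExp I G p.1 * (chartExp I G p.2)⁻¹) * k⁻¹)
  have hμ : ContDiffAt ℝ 2 μ (o, o) := by
    rw [← contMDiffAt_iff_contDiffAt]
    have h1 : ContMDiffAt 𝓘(ℝ, E × E) I 2 (fun p : E × E => chartExp I G p.1) (o, o) :=
      ContMDiffAt.comp (o, o) (contMDiffAt_chartExp (I := I) (G := G))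
        (contMDiffAt_iff_contDiffAt.2 contDiffAt_fst)
    have h2 : ContMDiffAt 𝓘(ℝ, E × E) I 2 (fun p : E × E => chartExp I G p.2) (o, o) :=
      ContMDiffAt.comp (o, o) (contMDiffAt_chartExp (I := I) (G := G))
        (contMDiffAt_iff_contDiffAt.2 contDiffAt_snd)
    have h3 := ((contMDiffAt_const (c := k)).mul (h1.mul h2.inv)).mul (contMDiffAt_const (c := k⁻¹))
    refine (contMDiffAt_extChartAt (x := (1 : G))).comp_of_eq h3 ?_
    simp [o, chartExp_origin]
  obtain ⟨D, hD⟩ : ∃ D, HasFDerivAt μ D (o, o) := ⟨_, (hμ.differentiableAt (by simp)).hasFDerivAt⟩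
  -- The derivative vanishes on the diagonal, where the quotient is constant.
  have hD0 : D.comp ((ContinuousLinearMap.id ℝ E).prod (ContinuousLinearMap.id ℝ E)) = 0 := by
    have h1 : HasFDerivAt (fun y => μ (y, y))
        (D.comp ((ContinuousLinearMap.id ℝ E).prod (ContinuousLinearMap.id ℝ E))) o :=
      HasFDerivAt.comp (g := μ) (f := fun y => (y, y)) o hD
        ((hasFDerivAt_id o).prodMk (hasFDerivAt_id o))
    refine h1.unique ?_
    have h2 : (fun y => μ (y, y)) = fun _ => extChartAt I (1 : G) 1 := by
      funext y; simp [μ]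
    rw [h2]
    exact hasFDerivAt_const _ _
  have hD' : D.comp (A.prod A) = 0 := by
    ext v
    exact congrArg (fun T => T (A v)) hD0
  rw [← hD']
  have hfg := hf.2.prodMk hg.2
  have hD3 : HasFDerivAt μ D (extChartAt I (1 : G) ((f x)⁻¹ * f x),
      extChartAt I (1 : G) ((g x)⁻¹ * g x)) := by
    rw [extChartAt_inv_mul_self, extChartAt_inv_mul_self]; exact hD
  have hev : ∀ z, chartExp I G (extChartAt I (1 : G) ((f x)⁻¹ * f z)) = (f x)⁻¹ * f z →
      chartExp I G (extChartAt I (1 : G) ((g x)⁻¹ * g z)) = (g x)⁻¹ * g z →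
      extChartAt I (1 : G) ((f x * (g x)⁻¹)⁻¹ * (f z * (g z)⁻¹))
        = μ (extChartAt I (1 : G) ((f x)⁻¹ * f z), extChartAt I (1 : G) ((g x)⁻¹ * g z)) := by
    intro z h1 h2
    simp only [μ]
    rw [h1, h2, hk]
    congr 1; group
  refine (hD3.comp_hasFDerivWithinAt x hfg).congr_of_eventuallyEq ?_ ?_
  · filter_upwards [(tendsto_inv_mul_nhds_one hf.1).eventually
      (chartExp_extChartAt_eventually (I := I)), (tendsto_inv_mul_nhds_one hg.1).eventually
      (chartExp_extChartAt_eventually (I := I))] with z h1 h2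
    exact hev z h1 h2
  · refine hev x ?_ ?_ <;> rw [extChartAt_inv_mul_self, chartExp_origin, inv_mul_cancel]

/-- A map with zero left logarithmic derivative at `x` has zero derivative at `x` in the chart
centred at the identity, translated to any `g` for which this chart covers `f x`. -/
theorem HasLogDerivWithinAt.hasFDerivWithinAt_translate_zero {f : X → G} {S : Set X} {x : X} {g : G}
    (hf : HasLogDerivWithinAt I f 0 S x) (hx : g⁻¹ * f x ∈ (extChartAt I (1 : G)).source) :
    HasFDerivWithinAt (fun z => extChartAt I (1 : G) (g⁻¹ * f z)) (0 : X →L[ℝ] E) S x := by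
  have : IsTopologicalGroup G := topologicalGroup_of_lieGroup I ∞
  set o := chartOrigin I G
  let μ : E → E := fun y => extChartAt I (1 : G) (g⁻¹ * f x * chartExp I G y)
  have hμ : ContDiffAt ℝ 2 μ o := by
    rw [← contMDiffAt_iff_contDiffAt]
    have h3 := (contMDiffAt_const (c := g⁻¹ * f x)).mul (contMDiffAt_chartExp (I := I) (G := G))
    refine (contMDiffAt_extChartAt' (x := (1 : G)) (x' := g⁻¹ * f x) (by simpa using hx)).comp_of_eq
      h3 ?_
    simpa using chartExp_origin (I := I) (G := G)
  have hD := (hμ.differentiableAt (by simp)).hasFDerivAt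
  have hD3 : HasFDerivAt μ (fderiv ℝ μ o) (extChartAt I (1 : G) ((f x)⁻¹ * f x)) := by
    rw [extChartAt_inv_mul_self]; exact hD
  have hev : ∀ z, chartExp I G (extChartAt I (1 : G) ((f x)⁻¹ * f z)) = (f x)⁻¹ * f z →
      extChartAt I (1 : G) (g⁻¹ * f z) = μ (extChartAt I (1 : G) ((f x)⁻¹ * f z)) := by
    intro z h1
    simp only [μ]
    rw [h1]
    congr 1; group
  have h := hD3.comp_hasFDerivWithinAt x hf.2
  rw [ContinuousLinearMap.comp_zero] at h
  refine h.congr_of_eventuallyEq ?_ ?_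
  · filter_upwards [(tendsto_inv_mul_nhds_one hf.1).eventually
      (chartExp_extChartAt_eventually (I := I))] with z h1
    exact hev z h1
  · refine hev x ?_
    rw [extChartAt_inv_mul_self, chartExp_origin, inv_mul_cancel]

/-- A map on a convex set with zero left logarithmic derivative is constant. -/
theorem eq_of_hasLogDerivWithinAt_zero {f : X → G} {S : Set X} (hS : Convex ℝ S)
    (hf : ∀ x ∈ S, HasLogDerivWithinAt I f 0 S x) {x y : X} (hx : x ∈ S) (hy : y ∈ S) :
    f x = f y := by
  have hloc : IsLocallyConstant (fun s : S => f s) := by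
    rw [IsLocallyConstant.iff_eventually_eq]
    rintro ⟨a, ha⟩
    have : IsTopologicalGroup G := topologicalGroup_of_lieGroup I ∞
    have h1 : ∀ᶠ z in 𝓝[S] a, (f a)⁻¹ * f z ∈ (extChartAt I (1 : G)).source :=
      (tendsto_inv_mul_nhds_one (hf a ha).1).eventually
        (extChartAt_source_mem_nhds (I := I) (1 : G))
    obtain ⟨ε, hε, h2⟩ := Metric.mem_nhdsWithin_iff.1 h1
    have hconst : ∀ z ∈ Metric.ball a ε ∩ S, f z = f a := by
      intro z hz
      have hconv : Convex ℝ (Metric.ball a ε ∩ S) := (convex_ball a ε).inter hS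
      have hd : ∀ w ∈ Metric.ball a ε ∩ S,
          HasFDerivWithinAt (fun z => extChartAt I (1 : G) ((f a)⁻¹ * f z)) (0 : X →L[ℝ] E)
            (Metric.ball a ε ∩ S) w := fun w hw =>
        ((hf w hw.2).hasFDerivWithinAt_translate_zero (h2 hw)).mono inter_subset_right
      have h3 := hconv.norm_image_sub_le_of_norm_hasFDerivWithin_le (C := 0) hd (by simp)
        ⟨Metric.mem_ball_self hε, ha⟩ hz
      rw [zero_mul, norm_le_zero_iff, sub_eq_zero] at h3
      have h4 := (extChartAt I (1 : G)).injOn (h2 hz) (h2 ⟨Metric.mem_ball_self hε, ha⟩) h3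
      exact mul_left_cancel h4
    have h5 : ∀ᶠ z in 𝓝[S] a, f z = f a :=
      mem_of_superset
        (by rw [inter_comm]; exact inter_mem_nhdsWithin _ (Metric.ball_mem_nhds a hε)) hconst
    rw [nhds_subtype_eq_comap_nhdsWithin]
    exact h5.comap Subtype.val
  have : PreconnectedSpace S := Subtype.preconnectedSpace hS.isPreconnected
  exact hloc.apply_eq_of_preconnectedSpace ⟨x, hx⟩ ⟨y, hy⟩

/-- Maps on a convex set with the same left logarithmic derivative agree if they agree at a
point. -/
theorem eqOn_of_hasLogDerivWithinAt {f g : X → G} {A : X → X →L[ℝ] E} {S : Set X}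
    (hS : Convex ℝ S) (hf : ∀ x ∈ S, HasLogDerivWithinAt I f (A x) S x)
    (hg : ∀ x ∈ S, HasLogDerivWithinAt I g (A x) S x) {x₀ : X} (hx₀ : x₀ ∈ S)
    (h : f x₀ = g x₀) : EqOn f g S := by
  intro x hx
  have h1 := eq_of_hasLogDerivWithinAt_zero (I := I) hS
    (fun x hx => (hf x hx).mul_inv_eq_zero (hg x hx)) hx hx₀
  simp only [h, mul_inv_cancel] at h1
  exact mul_inv_eq_one.1 h1

end LogDerivRules

/-! ### The Maurer–Cartan equation and the Lie bracket -/

section MaurerCartan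

variable {E : Type*} [NormedAddCommGroup E] [NormedSpace ℝ E]
  {H : Type*} [TopologicalSpace H] {I : ModelWithCorners ℝ E H}
  {G : Type*} [TopologicalSpace G] [ChartedSpace H G] [Group G]
  {X : Type*} [NormedAddCommGroup X] [NormedSpace ℝ X]

theorem HasLogDerivWithinAt.congr_of_eventuallyEq {f g : X → G} {A : X →L[ℝ] E} {S : Set X} {x : X}
    (h : HasLogDerivWithinAt I f A S x) (hg : g =ᶠ[𝓝[S] x] f) (hx : g x = f x) :
    HasLogDerivWithinAt I g A S x := by
  refine ⟨h.1.congr_of_eventuallyEq hg hx, h.2.congr_of_eventuallyEq ?_ (by simp only [hx])⟩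
  filter_upwards [hg] with z hz
  rw [hz, hx]

variable (I G) in
/-- The Maurer–Cartan form in the chart centred at the identity. -/
noncomputable def chartMaurerCartan : E → E →L[ℝ] E := leftLogDeriv I (chartExp I G)

variable (I G) in
/-- The Lie bracket of the Lie algebra as a continuous bilinear map of the model space, given as
minus the exterior derivative of the Maurer–Cartan form at the identity. -/
noncomputable def bracketCLM : E →L[ℝ] E →L[ℝ] E :=
  (fderiv ℝ (chartMaurerCartan I G) (chartOrigin I G)).flip
    - fderiv ℝ (chartMaurerCartan I G) (chartOrigin I G)

theorem bracketCLM_apply (v w : E) : bracketCLM I G v w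
    = fderiv ℝ (chartMaurerCartan I G) (chartOrigin I G) w v
      - fderiv ℝ (chartMaurerCartan I G) (chartOrigin I G) v w := rfl

theorem bracketCLM_swap (v w : E) : bracketCLM I G v w = -bracketCLM I G w v := by
  simp [bracketCLM_apply]

theorem bracketCLM_self (v : E) : bracketCLM I G v v = 0 := by
  simp [bracketCLM_apply]

theorem chartMaurerCartan_origin [I.Boundaryless] :
    chartMaurerCartan I G (chartOrigin I G) = ContinuousLinearMap.id ℝ E := by
  refine HasFDerivAt.fderiv ((hasFDerivAt_id _).congr_of_eventuallyEq ?_)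
  filter_upwards [extChartAt_chartExp_eventually (I := I) (G := G)] with y hy
  simpa [chartExp_origin] using hy

variable [LieGroup I ∞ G]

theorem hasLogDerivWithinAt_leftLogDeriv {f : X → G} {x : X}
    (hf : MDifferentiableAt 𝓘(ℝ, X) I f x) :
    HasLogDerivWithinAt I f (leftLogDeriv I f x) univ x := by
  obtain ⟨A, hA⟩ := hasLogDerivWithinAt_of_mdifferentiableWithinAt
    (mdifferentiableWithinAt_univ.2 hf)
  rwa [hA.leftLogDeriv_eq]

/-- The Maurer–Cartan form takes the value `v` on the left-invariant vector field of `v`. -/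
theorem mfderiv_inv_mul_mulInvariantVectorField (v : E) (x : G) :
    (mfderiv I I (fun y : G => x⁻¹ * y) x : E →L[ℝ] E)
      (mulInvariantVectorField (I := I) (v : GroupLieAlgebra I G) x) = v := by
  have hmul : ∀ g : G, MDifferentiable I I (fun y : G => g * y) := fun g =>
    (contMDiff_mul_left (I := I) (n := ∞)).mdifferentiable (by simp)
  have h1 := mfderiv_comp_apply_of_eq (1 : G) (hmul x⁻¹ x) (hmul x 1) (mul_one x) v
  have h2 : (fun y : G => x⁻¹ * y) ∘ (fun y => x * y) = id := by funext y; simp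
  rw [h2, mfderiv_id] at h1
  exact h1.symm

theorem contDiffAt_leftLogDeriv {f : X → G} {x : X} (hf : ContMDiffAt 𝓘(ℝ, X) I 2 f x) :
    ContDiffAt ℝ 1 (leftLogDeriv I f) x := by
  refine ContDiffAt.fderiv (f := fun y z => extChartAt I (1 : G) ((f y)⁻¹ * f z)) (g := id)
    (n := 2) ?_ contDiffAt_id (by norm_num)
  rw [← contMDiffAt_iff_contDiffAt]
  have h1 : ContMDiffAt 𝓘(ℝ, X × X) I 2 (fun p : X × X => f p.1) (x, x) :=
    ContMDiffAt.comp (x, x) hf (contMDiffAt_iff_contDiffAt.2 contDiffAt_fst)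
  have h2 : ContMDiffAt 𝓘(ℝ, X × X) I 2 (fun p : X × X => f p.2) (x, x) :=
    ContMDiffAt.comp (x, x) hf (contMDiffAt_iff_contDiffAt.2 contDiffAt_snd)
  exact (contMDiffAt_extChartAt (x := (1 : G))).comp_of_eq (h1.inv.mul h2) (by simp)

variable [I.Boundaryless]

theorem mdifferentiableAt_chartExp_eventually :
    ∀ᶠ y in 𝓝 (chartOrigin I G), MDifferentiableAt 𝓘(ℝ, E) I (chartExp I G) y := by
  filter_upwards [(isOpen_extChartAt_target (I := I) (1 : G)).mem_nhds
    (mem_extChartAt_target (I := I) (1 : G))] with y hy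
  exact ((contMDiffOn_extChartAt_symm (I := I) (n := ∞) (1 : G)).contMDiffAt
    ((isOpen_extChartAt_target (I := I) (1 : G)).mem_nhds hy)).mdifferentiableAt (by simp)

theorem contDiffAt_chartMaurerCartan :
    ContDiffAt ℝ 1 (chartMaurerCartan I G) (chartOrigin I G) :=
  contDiffAt_leftLogDeriv (contMDiffAt_chartExp (I := I) (G := G))

/-- The Maurer–Cartan equation for the left logarithmic derivative of a `C²` map. -/
theorem fderiv_leftLogDeriv_sub {f : X → G} {x₀ : X} (hf : ContMDiffAt 𝓘(ℝ, X) I 2 f x₀) (a b : X) :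
    fderiv ℝ (leftLogDeriv I f) x₀ a b - fderiv ℝ (leftLogDeriv I f) x₀ b a
      = -bracketCLM I G (leftLogDeriv I f x₀ a) (leftLogDeriv I f x₀ b) := by
  have : IsTopologicalGroup G := topologicalGroup_of_lieGroup I ∞
  set o := chartOrigin I G with ho
  set θ := chartMaurerCartan I G with hθdef
  let F : X → E := fun x => extChartAt I (1 : G) ((f x₀)⁻¹ * f x)
  have hFo : F x₀ = o := extChartAt_inv_mul_self f x₀
  have hF : ContDiffAt ℝ 2 F x₀ := by
    rw [← contMDiffAt_iff_contDiffAt]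
    exact (contMDiffAt_extChartAt (x := (1 : G))).comp_of_eq
      ((contMDiffAt_const (c := (f x₀)⁻¹)).mul hf) (by simp)
  have hFt : Tendsto F (𝓝 x₀) (𝓝 o) := by
    have := hF.continuousAt.tendsto
    rwa [hFo] at this
  have hfψ : ∀ᶠ x in 𝓝 x₀, f x = f x₀ * chartExp I G (F x) := by
    have h1 := tendsto_inv_mul_nhds_one (continuousWithinAt_univ _ _ |>.2 hf.continuousAt)
    rw [nhdsWithin_univ] at h1
    filter_upwards [h1.eventually (chartExp_extChartAt_eventually (I := I))] with x hx
    simp only [F, hx]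
    group
  -- Left translation by `f(x₀)` preserves the Maurer–Cartan form, whose pullback under `f` is thus
  -- that of its expression `θ` in the chart at the identity under `F`.
  have hfd : leftLogDeriv I f =ᶠ[𝓝 x₀] fun x => (θ (F x)).comp (fderiv ℝ F x) := by
    filter_upwards [hfψ.eventually_nhds, hF.eventually (by simp),
      hFt.eventually (mdifferentiableAt_chartExp_eventually (I := I) (G := G))] with x h1 h2 h3
    have h4 := (hasLogDerivWithinAt_leftLogDeriv h3).comp x
      (hasFDerivWithinAt_univ.2 (h2.differentiableAt (by simp)).hasFDerivAt) (mapsTo_univ _ univ)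
    have h5 := (h4.const_mul (f x₀)).congr_of_eventuallyEq (g := f)
      (by rw [nhdsWithin_univ]; exact h1) h1.self_of_nhds
    exact h5.leftLogDeriv_eq
  have hθ : HasFDerivAt θ (fderiv ℝ θ o) (F x₀) := by
    rw [hFo]
    exact ((contDiffAt_chartMaurerCartan (I := I) (G := G)).differentiableAt
      (by simp)).hasFDerivAt
  have hF1 : HasFDerivAt F (fderiv ℝ F x₀) x₀ := (hF.differentiableAt (by simp)).hasFDerivAt
  have hF2 : HasFDerivAt (fderiv ℝ F) (fderiv ℝ (fderiv ℝ F) x₀) x₀ :=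
    ((hF.fderiv_right (m := 1) (by norm_num)).differentiableAt (by simp)).hasFDerivAt
  have hsymm := (hF.isSymmSndFDerivAt (by simp)).eq a b
  have h1 : leftLogDeriv I f x₀ = fderiv ℝ F x₀ := by
    refine hfd.self_of_nhds.trans ?_
    simp only
    rw [hFo, hθdef, chartMaurerCartan_origin, ContinuousLinearMap.id_comp]
  have h2 := (HasFDerivAt.comp x₀ hθ hF1).clm_comp hF2
  have h3 := (h2.congr_of_eventuallyEq hfd).fderiv
  rw [h1, h3, bracketCLM_apply]
  have h5 : θ o = ContinuousLinearMap.id ℝ E := chartMaurerCartan_origin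
  simp only [add_apply, ContinuousLinearMap.comp_apply,
    ContinuousLinearMap.compL_apply, ContinuousLinearMap.flip_apply, Function.comp_apply, hFo, h5,
    ContinuousLinearMap.id_apply, hsymm]
  abel

variable [FiniteDimensional ℝ E]

theorem isInvertible_chartMaurerCartan_eventually :
    ∀ᶠ y in 𝓝 (chartOrigin I G), (chartMaurerCartan I G y).IsInvertible := by
  have : CompleteSpace E := FiniteDimensional.complete ℝ E
  have h1 := (contDiffAt_chartMaurerCartan (I := I) (G := G)).continuousAt
  have h2 := ContinuousLinearEquiv.nhds (ContinuousLinearEquiv.refl ℝ E)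
  refine h1.eventually (p := fun T => T.IsInvertible) ?_
  rw [chartMaurerCartan_origin]
  exact h2

theorem contDiffAt_inverse_chartMaurerCartan (v : E) :
    ContDiffAt ℝ 1 (fun y => (chartMaurerCartan I G y).inverse v) (chartOrigin I G) := by
  have : CompleteSpace E := FiniteDimensional.complete ℝ E
  have h1 : ContDiffAt ℝ 1 ContinuousLinearMap.inverse
      (chartMaurerCartan I G (chartOrigin I G)) := by
    rw [chartMaurerCartan_origin]
    exact contDiffAt_map_inverse (ContinuousLinearEquiv.refl ℝ E)
  exact (h1.comp (chartOrigin I G) (contDiffAt_chartMaurerCartan (I := I) (G := G))).clm_apply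
    contDiffAt_const

/-- The left-invariant vector fields in the chart at the identity are obtained by inverting the
Maurer–Cartan form. -/
theorem mpullbackWithin_mulInvariantVectorField_eventuallyEq (v : E) :
    (VectorField.mpullbackWithin 𝓘(ℝ, E) I (extChartAt I (1 : G)).symm
      (mulInvariantVectorField (I := I) (v : GroupLieAlgebra I G)) (range I) : E → E)
      =ᶠ[𝓝 (chartOrigin I G)] fun y => (chartMaurerCartan I G y).inverse v := by
  filter_upwards [isInvertible_chartMaurerCartan_eventually (I := I) (G := G),
    mdifferentiableAt_chartExp_eventually (I := I) (G := G),
    extChartAt_target_mem_nhds (I := I) (1 : G)] with y h1 h2 h3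
  have h4 := isInvertible_mfderivWithin_extChartAt_symm (I := I) h3
  have h5 := (hasLogDerivWithinAt_of_hasMFDerivWithinAt
    (hasMFDerivWithinAt_univ.2 h2.hasMFDerivAt)).leftLogDeriv_eq
  rw [VectorField.mpullbackWithin_apply]
  rw [I.range_eq_univ, mfderivWithin_univ] at h4 ⊢
  have h7 := mfderiv_inv_mul_mulInvariantVectorField (I := I) v (chartExp I G y)
  obtain ⟨D, hD⟩ : ∃ D : E →L[ℝ] E,
    D = (mfderiv 𝓘(ℝ, E) I (extChartAt I (1 : G)).symm y : E →L[ℝ] E) := ⟨_, rfl⟩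
  obtain ⟨T, hT⟩ : ∃ T : E →L[ℝ] E, T = (mfderiv I I (fun z : G => (chartExp I G y)⁻¹ * z)
    (chartExp I G y) : E →L[ℝ] E) := ⟨_, rfl⟩
  obtain ⟨u, hu⟩ : ∃ u : E, u = mulInvariantVectorField (I := I) (v : GroupLieAlgebra I G)
    ((extChartAt I (1 : G)).symm y) := ⟨_, rfl⟩
  replace h4 : D.IsInvertible := by rw [hD]; exact h4
  have h8 : D.inverse u = (chartMaurerCartan I G y).inverse v := by
    have h9 : T u = v := by rw [hT, hu]; exact h7
    have h10 : chartMaurerCartan I G y = T.comp D := by rw [hT, hD]; exact h5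
    obtain ⟨e, he⟩ := h1
    obtain ⟨d, rfl⟩ := h4
    rw [← he, ContinuousLinearMap.inverse_equiv, ContinuousLinearMap.inverse_equiv]
    refine (e.symm_apply_eq.2 ?_).symm
    change v = (e : E →L[ℝ] E) (d.symm u)
    rw [he, h10, ContinuousLinearMap.comp_apply]
    change v = T (d (d.symm u))
    rw [d.apply_symm_apply, h9]
  subst hu hD
  exact h8

/-- The Maurer–Cartan equation `dθ(v, w) = -[v, w]` at the identity: the left-invariant vector
fields are the constants in the frame given by the form `θ`. -/
theorem lie_eq_bracketCLM (v w : GroupLieAlgebra I G) :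
    (⁅v, w⁆ : GroupLieAlgebra I G) = bracketCLM I G v w := by
  set o := chartOrigin I G with ho
  set θ := chartMaurerCartan I G
  let V : E → E → E := fun v y => (θ y).inverse v
  have hθo : θ o = ContinuousLinearMap.id ℝ E := chartMaurerCartan_origin
  have hV0 : ∀ v, V v o = v := fun v => by
    simp only [V, hθo, ContinuousLinearMap.inverse_id]; rfl
  have hθ : HasFDerivAt θ (fderiv ℝ θ o) o :=
    ((contDiffAt_chartMaurerCartan (I := I) (G := G)).differentiableAt (by simp)).hasFDerivAt
  -- Differentiating `θ (V v) = v`.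
  have hV : ∀ v a : E, fderiv ℝ (V v) o a = - fderiv ℝ θ o a v := by
    intro v a
    have h1 : HasFDerivAt (V v) (fderiv ℝ (V v) o) o :=
      ((contDiffAt_inverse_chartMaurerCartan (I := I) (G := G) v).differentiableAt
        (by simp)).hasFDerivAt
    have h2 := hθ.clm_apply h1
    have h3 : HasFDerivAt (fun y => θ y (V v y)) (0 : E →L[ℝ] E) o := by
      refine (hasFDerivAt_const v o).congr_of_eventuallyEq ?_
      filter_upwards [isInvertible_chartMaurerCartan_eventually (I := I) (G := G)] with y hy
      obtain ⟨e, he⟩ := hy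
      simp only [V, θ, ← he, ContinuousLinearMap.inverse_equiv]
      exact e.apply_symm_apply v
    have h4 := congrArg (fun T : E →L[ℝ] E => T a) (h2.unique h3)
    simp only [add_apply, ContinuousLinearMap.comp_apply, hθo, hV0,
      ContinuousLinearMap.flip_apply, ContinuousLinearMap.id_apply, zero_apply] at h4
    exact eq_neg_of_add_eq_zero_left h4
  have hbr : ∀ v w : E, VectorField.lieBracket ℝ (V v) (V w) o = bracketCLM I G v w := by
    intro v w
    rw [VectorField.lieBracket_eq, bracketCLM_apply]
    simp only [hV, hV0]
    abel
  obtain ⟨T, hT⟩ : ∃ T : E →L[ℝ] E,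
    T = (mfderiv I 𝓘(ℝ, E) (extChartAt I (1 : G)) 1 : E →L[ℝ] E) := ⟨_, rfl⟩
  have hid : T = ContinuousLinearMap.id ℝ E := by rw [hT]; exact mfderiv_extChartAt_self
  obtain ⟨V', hV'⟩ : ∃ V' : E → E → E, V' = fun v : E => (VectorField.mpullbackWithin 𝓘(ℝ, E) I
    (extChartAt I (1 : G)).symm (mulInvariantVectorField (I := I) (v : GroupLieAlgebra I G))
      (range I) : E → E) := ⟨_, rfl⟩
  have hVV' : ∀ v, V' v =ᶠ[𝓝 o] V v := fun v => by
    rw [hV']; exact mpullbackWithin_mulInvariantVectorField_eventuallyEq v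
  have h1 : (⁅v, w⁆ : GroupLieAlgebra I G)
      = T.inverse
        (VectorField.lieBracketWithin ℝ (V' v) (V' w)
          ((extChartAt I (1 : G)).symm ⁻¹' univ ∩ range I) o) := by
    rw [hV', hT]; rfl
  have h2 : (extChartAt I (1 : G)).symm ⁻¹' univ ∩ range I = univ := by
    simp [I.range_eq_univ]
  rw [h1, h2, hid, VectorField.lieBracketWithin_univ, ContinuousLinearMap.inverse_id,
    (hVV' v).lieBracket_vectorField_eq (hVV' w)]
  exact hbr v w

end MaurerCartan

/-! ### One-parameter subgroups -/

section LinearODE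

variable {E : Type*} [NormedAddCommGroup E] [NormedSpace ℝ E]

/-- A solution of a linear differential equation `z' = A z` on an interval which vanishes at one
point vanishes identically, as `exp(-tA) z(t)` is constant. -/
theorem eq_zero_of_hasDerivWithinAt_clm [CompleteSpace E] (A : E →L[ℝ] E) {z : ℝ → E} {S : Set ℝ}
    (hS : Convex ℝ S) (hz : ∀ t ∈ S, HasDerivWithinAt z (A (z t)) S t) {t₀ t : ℝ}
    (ht₀ : t₀ ∈ S) (h0 : z t₀ = 0) (ht : t ∈ S) : z t = 0 := by
  let e : ℝ → E →L[ℝ] E := fun t => NormedSpace.exp (t • (-A))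
  have he : ∀ t, HasDerivAt e (e t * (-A)) t := fun t => hasDerivAt_exp_smul_const (-A) t
  have hc : ∀ t ∈ S, HasFDerivWithinAt (fun s => e s (z s)) (0 : ℝ →L[ℝ] E) S t := by
    intro t ht
    have h := (he t).hasDerivWithinAt.clm_apply (hz t ht)
    have h0 : (e t * (-A)) (z t) + e t (A (z t)) = 0 := by
      rw [mul_apply_eq_comp, ← map_add]
      simp
    rw [h0] at h
    simpa [hasDerivWithinAt_iff_hasFDerivWithinAt] using h
  have h1 := hS.norm_image_sub_le_of_norm_hasFDerivWithin_le (C := 0) hc (by simp) ht₀ ht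
  rw [zero_mul, norm_le_zero_iff, sub_eq_zero, h0, map_zero] at h1
  have h2 : IsUnit (e t) := NormedSpace.isUnit_exp_of_mem_ball (𝕂 := ℝ)
    ((NormedSpace.expSeries_radius_eq_top ℝ (E →L[ℝ] E)).symm ▸ edist_lt_top _ _)
  obtain ⟨u, hu⟩ := h2
  have h3 := congrArg (fun T : E →L[ℝ] E => T (z t)) u.inv_mul
  simpa [mul_apply_eq_comp, hu, h1] using h3.symm

/-- An integral curve of a `C¹` vector field is `C²`. -/
theorem contDiffAt_two_of_eventually_hasDerivAt {x : ℝ → E} {V : E → E} {t : ℝ}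
    (hx : ∀ᶠ s in 𝓝 t, HasDerivAt x (V (x s)) s) (hV : ContDiffAt ℝ 1 V (x t)) :
    ContDiffAt ℝ 2 x t := by
  have hc : ContinuousAt x t := hx.self_of_nhds.continuousAt
  obtain ⟨U, hU, hUo, htU⟩ := eventually_nhds_iff.1
    (hx.and (hc.eventually (hV.eventually (by simp))))
  have hd : DifferentiableOn ℝ x U := fun s hs =>
    (hU s hs).1.differentiableAt.differentiableWithinAt
  have hderiv : ∀ s ∈ U, deriv x s = V (x s) := fun s hs => (hU s hs).1.deriv
  have h0 : ContDiffOn ℝ 0 x U := contDiffOn_zero.2 hd.continuousOn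
  have hstep : ∀ n : ℕ, n ≤ 1 → ContDiffOn ℝ n x U → ContDiffOn ℝ ((n : WithTop ℕ∞) + 1) x U := by
    intro n hn h
    rw [contDiffOn_succ_iff_deriv_of_isOpen hUo]
    refine ⟨hd, by simp, ?_⟩
    have : ContDiffOn ℝ n (fun s => V (x s)) U := fun s hs =>
      ((hU s hs).2.of_le (by exact_mod_cast hn)).comp_contDiffWithinAt s (h s hs)
    exact this.congr hderiv
  have h1 := hstep 0 (by norm_num) (by exact_mod_cast h0)
  have h2 := hstep 1 le_rfl (by simpa using h1)
  have h3 : ContDiffOn ℝ 2 x U := by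
    have : ((1 : ℕ) : WithTop ℕ∞) + 1 = 2 := by norm_num
    rwa [this] at h2
  exact h3.contDiffAt (hUo.mem_nhds htU)

end LinearODE

section Exponential

variable {E : Type*} [NormedAddCommGroup E] [NormedSpace ℝ E]
  {H : Type*} [TopologicalSpace H] {I : ModelWithCorners ℝ E H}
  {G : Type*} [TopologicalSpace G] [ChartedSpace H G] [Group G] [LieGroup I ∞ G]
  {X : Type*} [NormedAddCommGroup X] [NormedSpace ℝ X]

theorem hasLogDerivWithinAt_of_isMIntegralCurve {v : E} {φ : ℝ → G}
    (h : IsMIntegralCurve (I := I) φ (mulInvariantVectorField (v : GroupLieAlgebra I G)))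
    (t : ℝ) : HasLogDerivWithinAt I φ (ContinuousLinearMap.toSpanSingleton ℝ v) univ t := by
  have h1 := hasLogDerivWithinAt_of_hasMFDerivWithinAt (hasMFDerivWithinAt_univ.2 (h t))
  have heq : ContinuousLinearMap.toSpanSingleton ℝ v
      = (mfderiv I I (fun y : G => (φ t)⁻¹ * y) (φ t) : E →L[ℝ] E).comp
        ((1 : ℝ →L[ℝ] ℝ).smulRight
          (mulInvariantVectorField (I := I) (v : GroupLieAlgebra I G) (φ t) : E)) := by
    refine ContinuousLinearMap.ext_ring ?_
    rw [ContinuousLinearMap.toSpanSingleton_apply, one_smul]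
    refine (mfderiv_inv_mul_mulInvariantVectorField (I := I) v (φ t)).symm.trans ?_
    refine congrArg (mfderiv I I (fun y : G => (φ t)⁻¹ * y) (φ t) : E →L[ℝ] E) ?_
    exact (one_smul ℝ (mulInvariantVectorField (I := I) (v : GroupLieAlgebra I G) (φ t) : E)).symm
  rw [heq]
  exact h1

variable [FiniteDimensional ℝ E] [I.Boundaryless]

theorem contMDiff_of_isMIntegralCurve {v : E} {φ : ℝ → G}
    (h : IsMIntegralCurve (I := I) φ (mulInvariantVectorField (v : GroupLieAlgebra I G))) :
    ContMDiff 𝓘(ℝ, ℝ) I 2 φ := by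
  have : IsTopologicalGroup G := topologicalGroup_of_lieGroup I ∞
  intro t
  let x : ℝ → E := fun s => extChartAt I (1 : G) ((φ t)⁻¹ * φ s)
  have hx0 : x t = chartOrigin I G := extChartAt_inv_mul_self φ t
  have htend : Tendsto (fun s => (φ t)⁻¹ * φ s) (𝓝 t) (𝓝 1) := by
    simpa [nhdsWithin_univ] using tendsto_inv_mul_nhds_one
      (continuousWithinAt_univ _ _ |>.2 (h t).continuousAt)
  have hxt : Tendsto x (𝓝 t) (𝓝 (chartOrigin I G)) :=
    (continuousAt_extChartAt (I := I) (1 : G)).tendsto.comp htend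
  have hφx : ∀ᶠ s in 𝓝 t, φ s = φ t * chartExp I G (x s) := by
    filter_upwards [htend.eventually (chartExp_extChartAt_eventually (I := I))] with s hs
    simp only [x, hs]
    group
  have hx' : ∀ᶠ s in 𝓝 t, HasDerivAt x ((chartMaurerCartan I G (x s)).inverse v) s := by
    filter_upwards [hφx.eventually_nhds,
      htend.eventually ((isOpen_extChartAt_source (I := I) (1 : G)).mem_nhds
        (mem_extChartAt_source (I := I) (1 : G))),
      hxt.eventually (mdifferentiableAt_chartExp_eventually (I := I) (G := G)),
      hxt.eventually (isInvertible_chartMaurerCartan_eventually (I := I) (G := G))]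
      with s h1 h2 h3 h4
    have hd : DifferentiableAt ℝ x s := by
      rw [← mdifferentiableAt_iff_differentiableAt]
      have h5 : MDifferentiableAt 𝓘(ℝ, ℝ) I (fun s => (φ t)⁻¹ * φ s) s :=
        MDifferentiableAt.comp s ((contMDiff_mul_left (I := I) (n := ∞)).mdifferentiable
          (by simp) _) (h s).mdifferentiableAt
      exact MDifferentiableAt.comp s (mdifferentiableAt_extChartAt
        (by rw [← extChartAt_source (I := I)]; exact h2)) h5
    have h5 := (((hasLogDerivWithinAt_leftLogDeriv h3).comp s
      (hasFDerivWithinAt_univ.2 hd.hasFDerivAt) (mapsTo_univ _ univ)).const_mul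
      (φ t)).congr_of_eventuallyEq (g := φ) (by rw [nhdsWithin_univ]; exact h1) h1.self_of_nhds
    have h6 := h5.unique (hasLogDerivWithinAt_of_isMIntegralCurve h s) uniqueDiffWithinAt_univ
    have h7 := congrArg (fun T : ℝ →L[ℝ] E => T 1) h6
    simp only [ContinuousLinearMap.comp_apply, ContinuousLinearMap.toSpanSingleton_apply, one_smul,
      fderiv_apply_one_eq_deriv] at h7
    obtain ⟨e, he⟩ := h4
    have h8 : chartMaurerCartan I G (x s) (deriv x s) = v := h7
    have h9 : deriv x s = (chartMaurerCartan I G (x s)).inverse v := by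
      rw [← h8, ← he, ContinuousLinearMap.inverse_equiv]
      exact (e.symm_apply_apply _).symm
    rw [← h9]
    exact hd.hasDerivAt
  have hx2 : ContDiffAt ℝ 2 x t := contDiffAt_two_of_eventually_hasDerivAt
    (V := fun y => (chartMaurerCartan I G y).inverse v) hx'
    (by rw [hx0]; exact contDiffAt_inverse_chartMaurerCartan v)
  have h10 : ContMDiffAt 𝓘(ℝ, ℝ) I 2 (fun s => φ t * chartExp I G (x s)) t := by
    refine contMDiffAt_const.mul ?_
    exact ContMDiffAt.comp_of_eq (g := chartExp I G) (contMDiffAt_chartExp (I := I) (G := G))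
      (contMDiffAt_iff_contDiffAt.2 hx2) hx0
  exact h10.congr_of_eventuallyEq hφx

section LieExp

variable [T2Space G]

variable (I G) in
/-- The curve `t ↦ exp(t v)` in the group, for `v` in the model space. -/
noncomputable def expCurve (v : E) (t : ℝ) : G := lieExp I (t • (v : GroupLieAlgebra I G))

/-- The curve `t ↦ exp(t v)` is the one-parameter subgroup of `v`. -/
theorem expCurve_spec (v : E) : expCurve I G v 0 = 1 ∧ IsMIntegralCurve (I := I) (expCurve I G v)
    (mulInvariantVectorField (v : GroupLieAlgebra I G)) := by
  obtain ⟨h0, hφ⟩ := (exists_oneParameterSubgroup (G := G) I v).choose_spec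
  suffices h : expCurve I G v = (exists_oneParameterSubgroup (G := G) I v).choose by
    rw [h]; exact ⟨h0, hφ⟩
  funext t
  have hex := exists_oneParameterSubgroup (G := G) I (t • (v : GroupLieAlgebra I G))
  obtain ⟨k0, hψ⟩ := hex.choose_spec
  set φ := (exists_oneParameterSubgroup (G := G) I v).choose
  -- The one-parameter subgroup of `t v`, whose value at `1` defines `exp(t v)`, is `s ↦ φ(t s)`.
  have h1 : EqOn hex.choose (fun s => φ (t * s)) univ := by
    refine eqOn_of_hasLogDerivWithinAt (I := I)
      (A := fun _ => ContinuousLinearMap.toSpanSingleton ℝ (t • (v : E))) convex_univ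
      (fun s _ => hasLogDerivWithinAt_of_isMIntegralCurve hψ s) (fun s _ => ?_)
      (mem_univ (0 : ℝ)) (by simp [k0, h0])
    have h2 : HasFDerivWithinAt (fun s : ℝ => t * s) (ContinuousLinearMap.toSpanSingleton ℝ t)
        univ s := by
      rw [← hasDerivWithinAt_iff_hasFDerivWithinAt]
      simpa using (((hasDerivAt_id s).const_mul t).hasDerivWithinAt (s := univ))
    convert (hasLogDerivWithinAt_of_isMIntegralCurve hφ (t * s)).comp s h2 (mapsTo_univ _ _)
      using 1
    refine ContinuousLinearMap.ext_ring ?_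
    change (1 : ℝ) • (t • (v : E)) = ((1 : ℝ) • t) • (v : E)
    rw [one_smul, one_smul]
  have h2 : hex.choose 1 = φ (t * 1) := h1 (mem_univ 1)
  rwa [mul_one] at h2

theorem expCurve_zero (v : E) : expCurve I G v 0 = 1 := (expCurve_spec v).1

theorem hasLogDerivWithinAt_expCurve (v : E) (t : ℝ) :
    HasLogDerivWithinAt I (expCurve I G v) (ContinuousLinearMap.toSpanSingleton ℝ v) univ t :=
  hasLogDerivWithinAt_of_isMIntegralCurve (expCurve_spec v).2 t

theorem contMDiff_expCurve (v : E) : ContMDiff 𝓘(ℝ, ℝ) I 2 (expCurve I G v) :=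
  contMDiff_of_isMIntegralCurve (expCurve_spec v).2

theorem expCurve_add (v : E) (s t : ℝ) :
    expCurve I G v (s + t) = expCurve I G v s * expCurve I G v t := by
  refine eqOn_of_hasLogDerivWithinAt (I := I) (f := fun t : ℝ => expCurve I G v (s + t))
    (g := fun t : ℝ => expCurve I G v s * expCurve I G v t)
    (A := fun _ => ContinuousLinearMap.toSpanSingleton ℝ v) convex_univ
    (fun t _ => ?_) (fun t _ => ?_) (mem_univ (0 : ℝ)) ?_ (mem_univ t)
  · have h2 : HasFDerivWithinAt (fun t : ℝ => s + t) (ContinuousLinearMap.toSpanSingleton ℝ (1 : ℝ))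
        univ t := by
      rw [← hasDerivWithinAt_iff_hasFDerivWithinAt]
      exact ((hasDerivAt_id t).const_add s).hasDerivWithinAt
    convert (hasLogDerivWithinAt_expCurve (I := I) (G := G) v (s + t)).comp t h2 (mapsTo_univ _ _)
      using 1
    ext
    simp
  · have : IsTopologicalGroup G := topologicalGroup_of_lieGroup I ∞
    exact (hasLogDerivWithinAt_expCurve v t).const_mul _
  · simp [expCurve_zero]

theorem inv_expCurve_neg (v : E) (t : ℝ) : (expCurve I G v (-t))⁻¹ = expCurve I G v t := by
  rw [inv_eq_iff_mul_eq_one, ← expCurve_add, neg_add_cancel, expCurve_zero]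

end LieExp

end Exponential

/-! ### The adjoint action and its derivative -/

section Adjoint

variable {E : Type*} [NormedAddCommGroup E] [NormedSpace ℝ E]
  {H : Type*} [TopologicalSpace H] {I : ModelWithCorners ℝ E H} [I.Boundaryless]
  {G : Type*} [TopologicalSpace G] [ChartedSpace H G] [Group G] [LieGroup I ∞ G]

theorem tendsto_conj_chartExp (g : G) :
    Tendsto (fun y => g * chartExp I G y * g⁻¹) (𝓝 (chartOrigin I G)) (𝓝 1) := by
  have : IsTopologicalGroup G := topologicalGroup_of_lieGroup I ∞
  have h : ContinuousAt (fun y => g * chartExp I G y * g⁻¹) (chartOrigin I G) :=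
    (continuousAt_const.mul (contMDiffAt_chartExp (I := I) (G := G)).continuousAt).mul
      continuousAt_const
  simpa [ContinuousAt, chartExp_origin] using h

variable [FiniteDimensional ℝ E] [T2Space G]

/-- The derivative of the adjoint action along a one-parameter subgroup is the Lie bracket. This is
the Maurer–Cartan equation for the map `(r, s) ↦ exp(r w) exp(-s v)`, whose left logarithmic
derivative is `Ad_{exp(s v)} w dr - v ds`. -/
theorem hasDerivAt_adjointCLM_expCurve (v w : E) (s : ℝ) :
    HasDerivAt (fun s : ℝ => adjointCLM I (expCurve I G v s) w)
      (bracketCLM I G v (adjointCLM I (expCurve I G v s) w)) s := by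
  obtain ⟨f, hfdef⟩ : ∃ f : ℝ × ℝ → G, f = fun p => expCurve I G w p.1 * expCurve I G v (-p.2) :=
    ⟨_, rfl⟩
  have hf : ContMDiff 𝓘(ℝ, ℝ × ℝ) I 2 f := by
    have h1 : ContMDiff 𝓘(ℝ, ℝ × ℝ) I 2 (fun p : ℝ × ℝ => expCurve I G w p.1) :=
      (contMDiff_expCurve (I := I) (G := G) w).comp (contMDiff_iff_contDiff.2 contDiff_fst)
    have h2 : ContMDiff 𝓘(ℝ, ℝ × ℝ) I 2 (fun p : ℝ × ℝ => expCurve I G v (-p.2)) :=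
      (contMDiff_expCurve (I := I) (G := G) v).comp (contMDiff_iff_contDiff.2 contDiff_snd.neg)
    rw [hfdef]
    exact h1.mul h2
  have hlog : ∀ p a : ℝ × ℝ, leftLogDeriv I f p a
      = a.1 • adjointCLM I (expCurve I G v p.2) w - a.2 • v := by
    intro p a
    have h1 := (hasLogDerivWithinAt_expCurve (I := I) (G := G) w p.1).comp p
      (hasFDerivAt_fst (𝕜 := ℝ) (p := p)).hasFDerivWithinAt (mapsTo_univ _ univ)
    have h2 := (hasLogDerivWithinAt_expCurve (I := I) (G := G) v (-p.2)).comp p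
      (hasFDerivAt_snd (𝕜 := ℝ) (p := p)).neg.hasFDerivWithinAt (mapsTo_univ _ univ)
    have h3 := (h1.mul h2).leftLogDeriv_eq
    have h4 := congrArg (fun T : ℝ × ℝ →L[ℝ] E => T a) h3
    rw [hfdef]
    refine h4.trans ?_
    have h5 : (expCurve I G v (-p.2))⁻¹ = expCurve I G v p.2 := inv_expCurve_neg v p.2
    simp [h5, sub_eq_add_neg]
  have hd : HasFDerivAt (leftLogDeriv I f) (fderiv ℝ (leftLogDeriv I f) (0, s)) (0, s) :=
    ((contDiffAt_leftLogDeriv (hf (0, s))).differentiableAt (by simp)).hasFDerivAt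
  have hmc := fderiv_leftLogDeriv_sub (hf (0, s)) (0, 1) (1, 0)
  have hcurve : ∀ (σ : ℝ → ℝ × ℝ) (σ' b : ℝ × ℝ) (t : ℝ), HasDerivAt σ σ' t → σ t = (0, s) →
      HasDerivAt (fun r => leftLogDeriv I f (σ r) b)
        (fderiv ℝ (leftLogDeriv I f) (0, s) σ' b) t := by
    intro σ σ' b t hσ ht
    rw [← ht] at hd ⊢
    have h3 := (hd.comp_hasDerivAt t hσ).clm_apply (hasDerivAt_const t b)
    rwa [map_zero, add_zero] at h3
  have h1 := hcurve (fun s' => (0, s')) (0, 1) (1, 0) s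
    ((hasDerivAt_const s 0).prodMk (hasDerivAt_id s)) rfl
  -- The coefficient `-v` of `ds` is constant.
  have h4 : fderiv ℝ (leftLogDeriv I f) (0, s) (1, 0) (0, 1) = 0 := by
    have h5 := hcurve (fun r => (r, s)) (1, 0) (0, 1) 0
      ((hasDerivAt_id (0 : ℝ)).prodMk (hasDerivAt_const 0 s)) rfl
    refine h5.unique ?_
    simp only [hlog]
    exact hasDerivAt_const _ _
  rw [h4, sub_zero] at hmc
  rw [hmc] at h1
  simp only [hlog, one_smul, zero_smul, sub_zero, zero_sub, map_neg, neg_apply, neg_neg] at h1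
  exact h1

theorem adjointCLM_expCurve_self (v : E) (t : ℝ) :
    adjointCLM I (expCurve I G v t) v = v := by
  have : CompleteSpace E := FiniteDimensional.complete ℝ E
  have h := eq_zero_of_hasDerivWithinAt_clm (bracketCLM I G v)
    (z := fun s : ℝ => adjointCLM I (expCurve I G v s) v - v) (S := univ) (t₀ := 0) (t := t)
    convex_univ (fun s _ => ?_) (mem_univ _) ?_ (mem_univ _)
  · exact sub_eq_zero.1 h
  · rw [map_sub, bracketCLM_self, sub_zero]
    exact ((hasDerivAt_adjointCLM_expCurve (I := I) (G := G) v v s).sub_const v).hasDerivWithinAt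
  · have h1 : expCurve I G v 0 = 1 := expCurve_zero (I := I) (G := G) v
    simp only [h1, adjointCLM_one, ContinuousLinearMap.id_apply, sub_self]

end Adjoint

/-! ### Homomorphisms of Lie groups -/

section Homomorphism

variable {E : Type*} [NormedAddCommGroup E] [NormedSpace ℝ E]
  {H : Type*} [TopologicalSpace H] {I : ModelWithCorners ℝ E H}
  {G : Type*} [TopologicalSpace G] [ChartedSpace H G] [Group G]
  {F : Type*} [NormedAddCommGroup F] [NormedSpace ℝ F]
  {N : Type*} [TopologicalSpace N] {J : ModelWithCorners ℝ F N} [J.Boundaryless]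
  {K : Type*} [TopologicalSpace K] [ChartedSpace N K] [Group K] [LieGroup J ∞ K]
  {ι : K →* G} {D : F →L[ℝ] E}

theorem HasLogDerivWithinAt.map {X : Type*} [NormedAddCommGroup X] [NormedSpace ℝ X] {f : X → K}
    {A : X →L[ℝ] F} {S : Set X} {x : X} (hf : HasLogDerivWithinAt J f A S x)
    (hι : Continuous ι) (hD : HasMFDerivAt J I ι (1 : K) D) :
    HasLogDerivWithinAt I (fun z => ι (f z)) (D.comp A) S x := by
  have : IsTopologicalGroup K := topologicalGroup_of_lieGroup J ∞
  refine ⟨hι.continuousAt.comp_continuousWithinAt hf.1, ?_⟩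
  have h1 := hasFDerivAt_comp_chartExp hD (map_one ι)
  rw [← extChartAt_inv_mul_self (I := J) f x] at h1
  have hev : ∀ z, chartExp J K (extChartAt J (1 : K) ((f x)⁻¹ * f z)) = (f x)⁻¹ * f z →
      extChartAt I (1 : G) ((ι (f x))⁻¹ * ι (f z)) = extChartAt I (1 : G)
        (ι (chartExp J K (extChartAt J (1 : K) ((f x)⁻¹ * f z)))) := fun z hz => by
    rw [hz, map_mul, map_inv]
  refine (HasFDerivAt.comp_hasFDerivWithinAt
    (g := fun y => extChartAt I (1 : G) (ι (chartExp J K y)))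
    x h1 hf.2).congr_of_eventuallyEq ?_ (hev x ?_)
  · filter_upwards [(tendsto_inv_mul_nhds_one hf.1).eventually
      (chartExp_extChartAt_eventually (I := J))] with z hz
    exact hev z hz
  · rw [extChartAt_inv_mul_self, chartExp_origin, inv_mul_cancel]

variable [I.Boundaryless] [LieGroup I ∞ G]

theorem adjointCLM_map (hι : Continuous ι) (hD : HasMFDerivAt J I ι (1 : K) D) (k : K) (b : F) :
    adjointCLM I (ι k) (D b) = D (adjointCLM J k b) := by
  have : IsTopologicalGroup K := topologicalGroup_of_lieGroup J ∞
  have h0 : extChartAt J (1 : K) (k * chartExp J K (chartOrigin J K) * k⁻¹) = chartOrigin J K := by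
    simp only [chartExp_origin, mul_one, mul_inv_cancel]; rfl
  have h0' : extChartAt I (1 : G) (ι (chartExp J K (chartOrigin J K))) = chartOrigin I G := by
    rw [chartExp_origin, map_one]; rfl
  have h1 := hasFDerivAt_comp_chartExp hD (map_one ι)
  have h2 := hasFDerivAt_conj_chartExp (I := I) (ι k)
  have h3 := h1
  rw [← h0'] at h2
  rw [← h0] at h3
  have h4 := HasFDerivAt.comp (g := fun y => extChartAt I (1 : G) (ι (chartExp J K y)))
    (f := fun y => extChartAt J (1 : K) (k * chartExp J K y * k⁻¹)) _ h3
    (hasFDerivAt_conj_chartExp (I := J) k)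
  have h5 : (adjointCLM I (ι k)).comp D = D.comp (adjointCLM J k) := by
    refine (HasFDerivAt.comp
      (g := fun y => extChartAt I (1 : G) (ι k * chartExp I G y * (ι k)⁻¹))
      (f := fun y => extChartAt I (1 : G) (ι (chartExp J K y)))
      _ h2 h1).unique (h4.congr_of_eventuallyEq ?_)
    have h6 : Tendsto (fun y => ι (chartExp J K y)) (𝓝 (chartOrigin J K)) (𝓝 1) := by
      have h7 : ContinuousAt (fun y => ι (chartExp J K y)) (chartOrigin J K) :=
        hι.continuousAt.comp (contMDiffAt_chartExp (I := J) (G := K)).continuousAt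
      simpa [ContinuousAt, chartExp_origin] using h7
    filter_upwards [h6.eventually (chartExp_extChartAt_eventually (I := I)),
      (tendsto_conj_chartExp (I := J) k).eventually
        (chartExp_extChartAt_eventually (I := J))] with y hy hy'
    simp only [Function.comp_apply, hy, hy', map_mul, map_inv]
  exact congrArg (fun T : F →L[ℝ] E => T b) h5

variable [FiniteDimensional ℝ E] [FiniteDimensional ℝ F] [T2Space G] [T2Space K]

theorem map_expCurve (hι : Continuous ι) (hD : HasMFDerivAt J I ι (1 : K) D) (a : F) (t : ℝ) :
    ι (expCurve J K a t) = expCurve I G (D a) t := by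
  refine eqOn_of_hasLogDerivWithinAt (I := I) (f := fun t : ℝ => ι (expCurve J K a t))
    (g := fun t : ℝ => expCurve I G (D a) t)
    (A := fun _ => ContinuousLinearMap.toSpanSingleton ℝ (D a)) convex_univ
    (fun t _ => ?_) (fun t _ => hasLogDerivWithinAt_expCurve (I := I) (G := G) (D a) t)
    (mem_univ (0 : ℝ)) ?_ (mem_univ t)
  · convert (hasLogDerivWithinAt_expCurve (I := J) (G := K) a t).map hι hD using 1
    refine ContinuousLinearMap.ext_ring ?_
    simp
  · have h1 : expCurve I G (D a) 0 = 1 := expCurve_zero (I := I) (G := G) (D a)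
    have h2 : expCurve J K a 0 = 1 := expCurve_zero (I := J) (G := K) a
    simp only [h1, h2, map_one]

/-- The derivative at the identity of a homomorphism of Lie groups is a homomorphism of Lie
algebras. -/
theorem bracketCLM_map (hι : Continuous ι) (hD : HasMFDerivAt J I ι (1 : K) D) (a b : F) :
    bracketCLM I G (D a) (D b) = D (bracketCLM J K a b) := by
  have h1 := hasDerivAt_adjointCLM_expCurve (I := I) (G := G) (D a) (D b) 0
  have h2 := D.hasFDerivAt.comp_hasDerivAt 0
    (hasDerivAt_adjointCLM_expCurve (I := J) (G := K) a b 0)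
  have h3 : (fun s : ℝ => adjointCLM I (expCurve I G (D a) s) (D b))
      = D ∘ fun s : ℝ => adjointCLM J (expCurve J K a s) b := by
    funext s
    rw [← map_expCurve hι hD, adjointCLM_map hι hD]
    rfl
  have h4 : expCurve I G (D a) 0 = 1 := expCurve_zero (I := I) (G := G) (D a)
  have h5 : expCurve J K a 0 = 1 := expCurve_zero (I := J) (G := K) a
  rw [h3] at h1
  simpa [h4, h5, adjointCLM_one] using h1.unique h2

end Homomorphism

/-! ### Geodesics of left-invariant metrics -/

section Geodesic

variable {E : Type*} [NormedAddCommGroup E] [NormedSpace ℝ E]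
  {H : Type*} [TopologicalSpace H] {I : ModelWithCorners ℝ E H} [I.Boundaryless]
  {G : Type*} [TopologicalSpace G] [ChartedSpace H G] [Group G] [LieGroup I ∞ G]

theorem contMDiffAt_extChartAt_symm_self (p : G) :
    ContMDiffAt 𝓘(ℝ, E) I 2 (extChartAt I p).symm (extChartAt I p p) :=
  (contMDiffOn_extChartAt_symm (I := I) p).contMDiffAt (extChartAt_target_mem_nhds (I := I) p)

variable [FiniteDimensional ℝ E]

theorem leftLogDeriv_extChartAt_symm_eventually (p : G) :
    ∀ᶠ y in 𝓝 (extChartAt I p p),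
      HasLogDerivWithinAt I (extChartAt I p).symm
        (leftLogDeriv I (extChartAt I p).symm y) univ y ∧
      ∀ v : E, leftTranslate I ((extChartAt I p).symm y)
        (mfderiv 𝓘(ℝ, E) I (extChartAt I p).symm y v)
        = leftLogDeriv I (extChartAt I p).symm y v := by
  filter_upwards [(isOpen_extChartAt_target (I := I) p).mem_nhds
    (mem_extChartAt_target (I := I) p)] with y hy
  have h1 : MDifferentiableAt 𝓘(ℝ, E) I (extChartAt I p).symm y :=
    ((contMDiffOn_extChartAt_symm (I := I) (n := ∞) p).contMDiffAt
      ((isOpen_extChartAt_target (I := I) p).mem_nhds hy)).mdifferentiableAt (by simp)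
  have h2 := hasLogDerivWithinAt_leftLogDeriv h1
  refine ⟨h2, fun v => ?_⟩
  have h3 := leftTranslate_mfderivWithin (mdifferentiableWithinAt_univ.2 h1) h2
    uniqueDiffWithinAt_univ v
  rwa [mfderivWithin_univ] at h3

theorem surjective_leftLogDeriv_extChartAt_symm (p : G) :
    Function.Surjective (leftLogDeriv I (extChartAt I p).symm (extChartAt I p p)) := by
  intro W
  have h1 := isInvertible_mfderivWithin_extChartAt_symm (I := I)
    (mem_extChartAt_target (I := I) p)
  rw [I.range_eq_univ, mfderivWithin_univ] at h1
  obtain ⟨d, hd⟩ := h1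
  obtain ⟨v, hv⟩ : ∃ v : E, v = d.symm (mulInvariantVectorField (I := I) (W : GroupLieAlgebra I G)
    ((extChartAt I p).symm (extChartAt I p p))) := ⟨_, rfl⟩
  refine ⟨v, ?_⟩
  rw [← (leftLogDeriv_extChartAt_symm_eventually (I := I) p).self_of_nhds.2, ← hd, hv]
  refine Eq.trans ?_ (mfderiv_inv_mul_mulInvariantVectorField (I := I) W
    ((extChartAt I p).symm (extChartAt I p p)))
  exact congrArg (mfderiv I I (fun y : G => ((extChartAt I p).symm (extChartAt I p p))⁻¹ * y)
    ((extChartAt I p).symm (extChartAt I p p)) : E →L[ℝ] E) (d.apply_symm_apply _)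

variable {b : LinearMap.BilinForm ℝ (GroupLieAlgebra I G)} {β : E →L[ℝ] E →L[ℝ] ℝ}

theorem chartMetric_eventually (hb : ∀ u v : E, b u v = β u v) (p : G) :
    ∀ᶠ y in 𝓝 (extChartAt I p p), ∀ v w : E, chartMetric I (leftInvariantMetric I b) p y v w
      = β (leftLogDeriv I (extChartAt I p).symm y v)
        (leftLogDeriv I (extChartAt I p).symm y w) := by
  filter_upwards [leftLogDeriv_extChartAt_symm_eventually (I := I) p] with y hy v w
  rw [← hy.2, ← hy.2]
  exact hb _ _

/-- The geodesic equation of a left-invariant metric in a chart, in terms of the Maurer–Cartan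
form `θ` in that chart. By the Maurer–Cartan equation the Christoffel symbols only involve the
symmetric derivative `θ'(v) v` and the bracket. -/
theorem chartMetric_add_christoffel (hb : ∀ u v : E, b u v = β u v) (hβ : ∀ u v, β u v = β v u)
    (p : G) (a v w : E) :
    chartMetric I (leftInvariantMetric I b) p (extChartAt I p p) a w
      + christoffel I (leftInvariantMetric I b) p (extChartAt I p p) v v w
    = β (leftLogDeriv I (extChartAt I p).symm (extChartAt I p p) a
          + fderiv ℝ (leftLogDeriv I (extChartAt I p).symm) (extChartAt I p p) v v)
        (leftLogDeriv I (extChartAt I p).symm (extChartAt I p p) w)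
      - β (leftLogDeriv I (extChartAt I p).symm (extChartAt I p p) v)
        (bracketCLM I G (leftLogDeriv I (extChartAt I p).symm (extChartAt I p p) v)
          (leftLogDeriv I (extChartAt I p).symm (extChartAt I p p) w)) := by
  set y₀ := extChartAt I p p
  set θ := leftLogDeriv I (extChartAt I p).symm
  have hθ : HasFDerivAt θ (fderiv ℝ θ y₀) y₀ :=
    ((contDiffAt_leftLogDeriv (contMDiffAt_extChartAt_symm_self (I := I) p)).differentiableAt
      (by simp)).hasFDerivAt
  have hmet := chartMetric_eventually (I := I) hb p
  have hd : ∀ v w u : E, fderiv ℝ (fun z => chartMetric I (leftInvariantMetric I b) p z v w) y₀ u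
      = β (fderiv ℝ θ y₀ u v) (θ y₀ w) + β (θ y₀ v) (fderiv ℝ θ y₀ u w) := by
    intro v w u
    have h1 : (fun z => chartMetric I (leftInvariantMetric I b) p z v w)
        =ᶠ[𝓝 y₀] fun z => β (θ z v) (θ z w) := by
      filter_upwards [hmet] with z hz using hz v w
    have hv : HasFDerivAt (fun z => θ z v) ((fderiv ℝ θ y₀).flip v) y₀ := by
      simpa using hθ.clm_apply (hasFDerivAt_const v y₀)
    have hw : HasFDerivAt (fun z => θ z w) ((fderiv ℝ θ y₀).flip w) y₀ := by
      simpa using hθ.clm_apply (hasFDerivAt_const w y₀)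
    have h2 := (β.hasFDerivAt.comp y₀ hv).clm_apply hw
    rw [h1.fderiv_eq]
    refine (congrArg (fun T : E →L[ℝ] ℝ => T u) h2.fderiv).trans ?_
    simp [add_comm]
  have hmc := fderiv_leftLogDeriv_sub (contMDiffAt_extChartAt_symm_self (I := I) p) v w
  rw [hmet.self_of_nhds, christoffel, hd, hd, ← neg_eq_iff_eq_neg.2 hmc]
  simp only [map_add, map_sub, map_neg, add_apply]
  rw [hβ (fderiv ℝ θ y₀ w v) (θ y₀ v)]
  ring

/-- The second derivative of a curve in a chart gives the derivative of its left-translated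
velocity. -/
theorem hasDerivWithinAt_velocity {γ : ℝ → G} {S : Set ℝ} (hS : UniqueDiffOn ℝ S)
    (hγ : ContMDiffOn 𝓘(ℝ, ℝ) I 2 γ S) {u : ℝ → E}
    (hu : ∀ s ∈ S, HasLogDerivWithinAt I γ (ContinuousLinearMap.toSpanSingleton ℝ (u s)) S s)
    {t : ℝ} (ht : t ∈ S) {x : ℝ → E} (hx : x = fun s => extChartAt I (γ t) (γ s)) :
    u t = leftLogDeriv I (extChartAt I (γ t)).symm (x t) (derivWithin x S t) ∧
    HasDerivWithinAt u
      (leftLogDeriv I (extChartAt I (γ t)).symm (x t) (derivWithin (derivWithin x S) S t)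
        + fderiv ℝ (leftLogDeriv I (extChartAt I (γ t)).symm) (x t)
          (derivWithin x S t) (derivWithin x S t)) S t := by
  set θ := leftLogDeriv I (extChartAt I (γ t)).symm
  have hxt : x t = extChartAt I (γ t) (γ t) := by rw [hx]
  have hcont : ContinuousWithinAt γ S t := (hγ t ht).continuousWithinAt
  have hsrc : ∀ᶠ s in 𝓝[S] t, γ s ∈ (extChartAt I (γ t)).source :=
    hcont.eventually (extChartAt_source_mem_nhds (I := I) (γ t))
  have hx2 : ∀ s ∈ S, γ s ∈ (extChartAt I (γ t)).source → ContDiffWithinAt ℝ 2 x S s := by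
    intro s hs hsrc
    rw [← contMDiffWithinAt_iff_contDiffWithinAt, hx]
    exact (contMDiffAt_extChartAt' (by rwa [← extChartAt_source (I := I)])).comp_contMDiffWithinAt s
      (hγ s hs)
  have hx2t := hx2 t ht (mem_extChartAt_source (I := I) (γ t))
  have hxc : Tendsto x (𝓝[S] t) (𝓝 (extChartAt I (γ t) (γ t))) := by
    rw [← hxt]; exact hx2t.continuousWithinAt
  have hev : ∀ᶠ s in 𝓝[S] t, u s = θ (x s) (derivWithin x S s) := by
    filter_upwards [eventually_eventually_nhdsWithin.2 hsrc, self_mem_nhdsWithin,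
      hxc.eventually (leftLogDeriv_extChartAt_symm_eventually (I := I) (γ t))] with s h1 hs h2
    have h1s := h1.self_of_nhdsWithin hs
    have h3 := ((hx2 s hs h1s).differentiableWithinAt (by simp)).hasDerivWithinAt
    rw [hasDerivWithinAt_iff_hasFDerivWithinAt] at h3
    have hinv : ∀ r, γ r ∈ (extChartAt I (γ t)).source →
        γ r = (extChartAt I (γ t)).symm (x r) := fun r hr => by
      rw [hx]; exact ((extChartAt I (γ t)).left_inv hr).symm
    have h4 := (h2.1.comp s h3 (mapsTo_univ _ _)).congr_of_eventuallyEq (g := γ)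
      (h1.mono hinv) (hinv s h1s)
    have h5 := (hu s hs).unique h4 (hS s hs)
    have h6 := congrArg (fun T : ℝ →L[ℝ] E => T 1) h5
    simpa only [ContinuousLinearMap.toSpanSingleton_apply, one_smul,
      ContinuousLinearMap.comp_apply] using h6
  have hut := hev.self_of_nhdsWithin ht
  refine ⟨hut, ?_⟩
  have hθ : HasFDerivAt θ (fderiv ℝ θ (x t)) (x t) := by
    rw [hxt]
    exact ((contDiffAt_leftLogDeriv
      (contMDiffAt_extChartAt_symm_self (I := I) (γ t))).differentiableAt (by simp)).hasFDerivAt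
  have h1 := (hx2t.differentiableWithinAt (by simp)).hasDerivWithinAt
  have h2 : HasDerivWithinAt (derivWithin x S) (derivWithin (derivWithin x S) S t) S t := by
    have h3 := hx2t.fderivWithin_right (m := 1) hS (by norm_num) ht
    have h4 : DifferentiableWithinAt ℝ (derivWithin x S) S t :=
      (h3.differentiableWithinAt (by simp)).clm_apply (differentiableWithinAt_const (1 : ℝ))
    exact h4.hasDerivWithinAt
  have h3 := (hθ.comp_hasDerivWithinAt t h1).clm_apply h2
  rw [add_comm] at h3
  exact h3.congr_of_eventuallyEq hev hut

/-- A curve is a geodesic of a left-invariant metric if and only if its left-translated velocity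
`u` satisfies the Euler–Arnold equation `⟨u', w⟩ = ⟨u, [u, w]⟩`. -/
theorem isGeodesicOn_leftInvariantMetric_iff (hb : ∀ u v : E, b u v = β u v)
    (hβ : ∀ u v, β u v = β v u) {γ : ℝ → G} {S : Set ℝ} (hS : UniqueDiffOn ℝ S) {u : ℝ → E}
    (hu : ∀ s ∈ S, HasLogDerivWithinAt I γ (ContinuousLinearMap.toSpanSingleton ℝ (u s)) S s) :
    IsGeodesicOn I (leftInvariantMetric I b) γ S ↔
      ContMDiffOn 𝓘(ℝ, ℝ) I 2 γ S ∧ ∀ t ∈ S, ∃ u' : E, HasDerivWithinAt u u' S t ∧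
        ∀ w, β u' w = β (u t) (bracketCLM I G (u t) w) := by
  refine and_congr_right fun hγ => forall₂_congr fun t ht => ?_
  obtain ⟨h1, h2⟩ := hasDerivWithinAt_velocity hS hγ hu ht rfl
  constructor
  · intro h
    refine ⟨_, h2, fun w => ?_⟩
    obtain ⟨w, rfl⟩ := surjective_leftLogDeriv_extChartAt_symm (I := I) (γ t) w
    have h3 := h w
    rw [chartMetric_add_christoffel hb hβ, sub_eq_zero] at h3
    rw [h1]
    exact h3
  · rintro ⟨u', h3, h4⟩
    intro x x' x'' w
    have h5 := (hS t ht).eq_deriv _ h3 h2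
    have h6 := h4 (leftLogDeriv I (extChartAt I (γ t)).symm (extChartAt I (γ t) (γ t)) w)
    refine (chartMetric_add_christoffel hb hβ (γ t) (x'' t) (x' t) w).trans ?_
    rw [sub_eq_zero]
    rw [h5, h1] at h6
    exact h6

end Geodesic

/-! ### The Euler–Arnold equation of the Cheeger deformation -/

section EulerArnold

variable {E : Type*} [NormedAddCommGroup E] [NormedSpace ℝ E]
  {L : E →L[ℝ] E →L[ℝ] E} {Q : E →L[ℝ] E →L[ℝ] ℝ} {P : E →L[ℝ] E} {δ : ℝ}

/-- An operator `ad_{P u}` of the subalgebra commutes with the orthogonal projection, since it is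
skew-symmetric and preserves the subalgebra. -/
theorem proj_bracket_proj (hQ0 : ∀ u, Q u u = 0 → u = 0)
    (hinv : ∀ u v w, Q (L u v) w + Q v (L u w) = 0) (hP : ∀ u v, Q (P u) v = Q u (P v))
    (hPP : ∀ u, P (P u) = P u) (hPL : ∀ u v, P (L (P u) (P v)) = L (P u) (P v)) (u v : E) :
    P (L (P u) v) = L (P u) (P v) := by
  rw [← sub_eq_zero]
  refine hQ0 _ ?_
  set w := P (L (P u) v) - L (P u) (P v) with hw
  have hPw : P w = w := by rw [hw, map_sub, hPP, hPL]
  have h1 : w = P (L (P u) (v - P v)) := by rw [map_sub, map_sub, hPL]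
  have h2 : Q (L (P u) (v - P v)) w = -Q (v - P v) (L (P u) w) :=
    eq_neg_of_add_eq_zero_left (hinv _ _ _)
  calc Q w w = Q (L (P u) (v - P v)) (P w) := by rw [← hP, ← h1]
    _ = -Q (v - P v) (P (L (P u) (P w))) := by rw [hPL, hPw, h2]
    _ = 0 := by rw [← hP, map_sub, hPP, sub_self, map_zero]; simp

/-- The Euler–Arnold equation of the Cheeger deformation is `u' = δ [P u, u]`. -/
theorem eulerArnold_cheeger_iff (hL : ∀ u v, L u v = -L v u) (hL0 : ∀ u, L u u = 0)
    (hQ0 : ∀ u, Q u u = 0 → u = 0)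
    (hinv : ∀ u v w, Q (L u v) w + Q v (L u w) = 0) (hP : ∀ u v, Q (P u) v = Q u (P v))
    (hPP : ∀ u, P (P u) = P u) (hPL : ∀ u v, P (L (P u) (P v)) = L (P u) (P v))
    (hδ : 1 + δ ≠ 0) {β : E →L[ℝ] E →L[ℝ] ℝ} (hβ : ∀ u v, β u v = Q u v + δ * Q (P u) (P v))
    (u a : E) : (∀ w, β a w = β u (L u w)) ↔ a = δ • L (P u) u := by
  have hβ' : ∀ u v, β u v = Q (u + δ • P u) v := fun u v => by
    rw [hβ, hP u (P v), hPP, ← hP]; simp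
  have h1 : ∀ w, β u (L u w) = Q (δ • L (P u) u) w := by
    intro w
    rw [hβ', eq_neg_of_add_eq_zero_right (hinv u (u + δ • P u) w), map_add, hL0, map_smul,
      hL u (P u)]
    simp
  have h2 : P (L (P u) u) = 0 := by rw [proj_bracket_proj hQ0 hinv hP hPP hPL, hL0]
  have h3 : (∀ w, β a w = β u (L u w)) ↔ a + δ • P a = δ • L (P u) u := by
    constructor
    · intro h
      rw [← sub_eq_zero]
      refine hQ0 _ ?_
      have h4 : ∀ w, Q (a + δ • P a - δ • L (P u) u) w = 0 := fun w => by
        rw [map_sub Q, sub_apply, ← hβ', ← h1, h, sub_self]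
      exact h4 _
    · intro h w
      rw [h1, hβ', h]
  rw [h3]
  constructor
  · intro h
    have h4 : (1 + δ) • P a = 0 := by
      have h5 := congrArg P h
      rw [map_add, map_smul, map_smul, hPP, h2, smul_zero] at h5
      rw [add_smul, one_smul, h5]
    rw [(smul_eq_zero.1 h4).resolve_left hδ, smul_zero, add_zero] at h
    exact h
  · intro h
    have h4 : P a = 0 := by rw [h, map_smul, h2, smul_zero]
    rw [h4, smul_zero, add_zero, h]

variable [CompleteSpace E]

/-- For a solution of `u' = δ [P u, u]` the component `P u` is constant, and then `u` solves the
linear equation `u' = δ [p₀, u]`. -/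
theorem eqOn_of_hasDerivWithinAt_bracket_proj (hL0 : ∀ u, L u u = 0)
    (hPL : ∀ u v, P (L (P u) v) = L (P u) (P v)) {S : Set ℝ} (hS : Convex ℝ S) {t₀ : ℝ}
    (ht₀ : t₀ ∈ S) {u z : ℝ → E} {p₀ : E}
    (hu : ∀ t ∈ S, HasDerivWithinAt u (δ • L (P (u t)) (u t)) S t)
    (hz : ∀ t ∈ S, HasDerivWithinAt z (δ • L p₀ (z t)) S t)
    (h0 : u t₀ = z t₀) (hp : P (u t₀) = p₀) : EqOn u z S := by
  have h1 : ∀ t ∈ S, P (u t) = p₀ := by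
    intro t ht
    refine sub_eq_zero.1 (eq_zero_of_hasDerivWithinAt_clm (0 : E →L[ℝ] E)
      (z := fun t => P (u t) - p₀) hS (fun s hs => ?_) ht₀ (by simp [hp]) ht)
    have h2 := ((P.hasFDerivAt.comp_hasDerivWithinAt s (hu s hs)).sub_const p₀)
    rw [map_smul, hPL, hL0, smul_zero] at h2
    simpa using h2
  intro t ht
  refine sub_eq_zero.1 (eq_zero_of_hasDerivWithinAt_clm (δ • L p₀) (z := fun t => u t - z t) hS
    (fun s hs => ?_) ht₀ (by simp [h0]) ht)
  have h2 := (hu s hs).sub (hz s hs)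
  rw [h1 s hs, ← smul_sub, ← map_sub] at h2
  exact h2

/-- A solution of the linear equation `z' = δ [p₀, z]` with `P z(t₀) = p₀` keeps `P z = p₀`. -/
theorem proj_eq_of_hasDerivWithinAt_bracket (hL0 : ∀ u, L u u = 0)
    (hPL : ∀ u v, P (L (P u) v) = L (P u) (P v)) {S : Set ℝ} (hS : Convex ℝ S) {t₀ : ℝ}
    (ht₀ : t₀ ∈ S) {z : ℝ → E} {p₀ : E} (hp₀ : P p₀ = p₀)
    (hz : ∀ t ∈ S, HasDerivWithinAt z (δ • L p₀ (z t)) S t) (h0 : P (z t₀) = p₀) :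
    ∀ t ∈ S, P (z t) = p₀ := by
  intro t ht
  refine sub_eq_zero.1 (eq_zero_of_hasDerivWithinAt_clm (δ • L p₀)
    (z := fun t => P (z t) - p₀) hS (fun s hs => ?_) ht₀ (by simp [h0]) ht)
  have h2 := ((P.hasFDerivAt.comp_hasDerivWithinAt s (hz s hs)).sub_const p₀)
  have h3 : P (δ • L p₀ (z s)) = (δ • L p₀) (P (z s) - p₀) := by
    have h4 := hPL p₀ (z s)
    rw [hp₀] at h4
    rw [map_smul, h4, map_sub]
    simp [hL0]
  rw [h3] at h2
  exact h2

end EulerArnold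

section Projection

variable {E : Type*} [NormedAddCommGroup E] [NormedSpace ℝ E] [FiniteDimensional ℝ E]
  {H : Type*} [TopologicalSpace H] {I : ModelWithCorners ℝ E H}
  {G : Type*} [TopologicalSpace G] [ChartedSpace H G] [Group G]
  (B : BiInvariantMetric I G) (𝔥 : Submodule ℝ (GroupLieAlgebra I G))

namespace BiInvariantMetric

theorem proj_mem (u : GroupLieAlgebra I G) : B.proj 𝔥 u ∈ 𝔥 :=
  Submodule.projection_apply_mem _ _

theorem proj_of_mem {u : GroupLieAlgebra I G} (hu : u ∈ 𝔥) : B.proj 𝔥 u = u :=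
  Submodule.projection_apply_left (B.isCompl_perp 𝔥) ⟨u, hu⟩

theorem proj_of_mem_perp {u : GroupLieAlgebra I G} (hu : u ∈ B.perp 𝔥) : B.proj 𝔥 u = 0 :=
  (Submodule.projection_apply_eq_zero_iff (B.isCompl_perp 𝔥)).2 hu

theorem proj_proj (u : GroupLieAlgebra I G) : B.proj 𝔥 (B.proj 𝔥 u) = B.proj 𝔥 u :=
  B.proj_of_mem 𝔥 (B.proj_mem 𝔥 u)

theorem sub_proj_mem_perp (u : GroupLieAlgebra I G) : u - B.proj 𝔥 u ∈ B.perp 𝔥 := by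
  rw [← Submodule.projection_apply_eq_zero_iff (B.isCompl_perp 𝔥)]
  exact (map_sub _ _ _).trans (sub_eq_zero.2 (B.proj_proj 𝔥 u).symm)

theorem form_proj_left (u v : GroupLieAlgebra I G) :
    B.form (B.proj 𝔥 u) v = B.form u (B.proj 𝔥 v) := by
  have h : ∀ u v : GroupLieAlgebra I G,
      B.form (B.proj 𝔥 u) v = B.form (B.proj 𝔥 u) (B.proj 𝔥 v) := fun u v => by
    rw [← sub_eq_zero, ← map_sub]
    exact B.sub_proj_mem_perp 𝔥 v _ (B.proj_mem 𝔥 u)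
  rw [h, B.symm u, h v u, B.symm]

end BiInvariantMetric

end Projection

/-! ### Geodesics of the Cheeger deformation -/

section CheegerGeodesics

variable {E : Type*} [NormedAddCommGroup E] [NormedSpace ℝ E]
  {H : Type*} [TopologicalSpace H] {I : ModelWithCorners ℝ E H}
  {G : Type*} [TopologicalSpace G] [ChartedSpace H G] [Group G]

/-- A tangent vector, given with its base point, equals `v` at the identity if and only if the
base point is the identity and its left translate is `v`. -/
theorem tangentBundle_mk_eq_one_iff (x : G) (w : TangentSpace I x) (v : GroupLieAlgebra I G) :
    (⟨x, w⟩ : TangentBundle I G) = ⟨1, v⟩ ↔ x = 1 ∧ leftTranslate I x w = v := by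
  have h1 : ∀ v : GroupLieAlgebra I G, leftTranslate I (1 : G) v = v := fun v => by
    have h : (fun y : G => (1 : G)⁻¹ * y) = id := by funext y; simp
    change mfderiv I I (fun y : G => (1 : G)⁻¹ * y) 1 v = v
    rw [h, mfderiv_id]
    rfl
  constructor
  · intro h
    have h2 := congrArg (fun ξ : TangentBundle I G => leftTranslate I ξ.1 ξ.2) h
    exact ⟨congrArg (fun ξ : TangentBundle I G => ξ.1) h, h2.trans (h1 v)⟩
  · rintro ⟨rfl, h⟩
    rw [h1] at h
    rw [h]

variable [LieGroup I ∞ G]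

/-- A curve of class `C²` has a left-translated velocity. -/
theorem exists_velocity {γ : ℝ → G} {S : Set ℝ} (hγ : ContMDiffOn 𝓘(ℝ, ℝ) I 2 γ S) :
    ∃ u : ℝ → E, ∀ s ∈ S,
      HasLogDerivWithinAt I γ (ContinuousLinearMap.toSpanSingleton ℝ (u s)) S s := by
  have h : ∀ s, ∃ u : E, s ∈ S →
      HasLogDerivWithinAt I γ (ContinuousLinearMap.toSpanSingleton ℝ u) S s := by
    intro s
    by_cases hs : s ∈ S
    · obtain ⟨A, hA⟩ := hasLogDerivWithinAt_of_mdifferentiableWithinAt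
        ((hγ s hs).mdifferentiableWithinAt (by simp))
      refine ⟨A 1, fun _ => ?_⟩
      have hA' : ContinuousLinearMap.toSpanSingleton ℝ (A 1) = A :=
        ContinuousLinearMap.ext_ring (by simp)
      rwa [hA']
    · exact ⟨0, fun h => absurd h hs⟩
  choose u hu using h
  exact ⟨u, hu⟩

variable [FiniteDimensional ℝ E] [I.Boundaryless] [T2Space G]

/-- The left-translated velocity of `exp(t (u + δ p)) exp(-δ t p)` is `Ad_{exp(δ t p)} u`. -/
theorem hasLogDerivWithinAt_expCurve_mul (u p : E) (δ t : ℝ) :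
    HasLogDerivWithinAt I (fun t => expCurve I G (u + δ • p) t * expCurve I G p (-(δ * t)))
      (ContinuousLinearMap.toSpanSingleton ℝ (adjointCLM I (expCurve I G p (δ * t)) u)) univ t := by
  have h1 : HasFDerivWithinAt (fun t : ℝ => -(δ * t)) (ContinuousLinearMap.toSpanSingleton ℝ (-δ))
      univ t := by
    rw [← hasDerivWithinAt_iff_hasFDerivWithinAt, hasDerivWithinAt_univ]
    have h := ((hasDerivAt_id t).const_mul δ).neg
    rw [mul_one] at h
    exact h
  have h2 := (hasLogDerivWithinAt_expCurve (I := I) (G := G) (u + δ • p) t).mul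
    ((hasLogDerivWithinAt_expCurve (I := I) (G := G) p (-(δ * t))).comp t h1 (mapsTo_univ _ _))
  convert h2 using 1
  refine ContinuousLinearMap.ext_ring ?_
  simp only [inv_expCurve_neg, add_apply, ContinuousLinearMap.comp_apply,
    ContinuousLinearMap.toSpanSingleton_apply, one_smul, map_add, map_smul,
    adjointCLM_expCurve_self, neg_smul]
  abel

theorem hasDerivAt_adjointCLM_expCurve_mul (p v : E) (δ t : ℝ) :
    HasDerivAt (fun t : ℝ => adjointCLM I (expCurve I G p (δ * t)) v)
      (δ • bracketCLM I G p (adjointCLM I (expCurve I G p (δ * t)) v)) t := by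
  have h1 : HasDerivAt (fun t : ℝ => δ * t) δ t := by
    simpa using (hasDerivAt_id t).const_mul δ
  exact (hasDerivAt_adjointCLM_expCurve (I := I) (G := G) p v (δ * t)).scomp t h1

end CheegerGeodesics

theorem mainTheorem8
    -- the Lie group `G`
    {E : Type*} [NormedAddCommGroup E] [NormedSpace ℝ E] [FiniteDimensional ℝ E]
    {H : Type*} [TopologicalSpace H] (I : ModelWithCorners ℝ E H) [I.Boundaryless]
    {G : Type*} [TopologicalSpace G] [T2Space G] [ChartedSpace H G] [Group G] [LieGroup I ∞ G]
    -- the Lie subgroup, a Lie group `K` with an injective immersive homomorphism into `G`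
    {F : Type*} [NormedAddCommGroup F] [NormedSpace ℝ F] [FiniteDimensional ℝ F]
    {N : Type*} [TopologicalSpace N] (J : ModelWithCorners ℝ F N) [J.Boundaryless]
    {K : Type*} [TopologicalSpace K] [T2Space K] [ChartedSpace N K] [Group K] [LieGroup J ∞ K]
    (ι : K →* G) (hinj : Function.Injective ι) (himm : IsImmersion J I ∞ ι)
    -- the bi-invariant metric, the deformation parameter and the initial velocity
    (B : BiInvariantMetric I G) (δ : ℝ) (hδ : -1 < δ)
    (p₀ q₀ : GroupLieAlgebra I G) (hp : p₀ ∈ subgroupLieAlgebra I J ι)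
    (hq : q₀ ∈ B.perp (subgroupLieAlgebra I J ι)) :
    let 𝔥 := subgroupLieAlgebra I J ι
    let g : (x : G) → LinearMap.BilinForm ℝ (TangentSpace I x) :=
      leftInvariantMetric I (B.cheegerForm 𝔥 δ)
    let c : ℝ → G := fun t => lieExp I (t • B.Lam 𝔥 δ (p₀ + q₀)) * lieExp I (-(δ * t) • p₀)
    -- the formula defines a geodesic with the given initial point and velocity
    (IsGeodesicOn I g c univ ∧
      (⟨c 0, mfderiv 𝓘(ℝ, ℝ) I c 0 (1 : ℝ)⟩ : TangentBundle I G) = ⟨1, p₀ + q₀⟩) ∧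
    -- every geodesic with this initial point and velocity is given by the formula
    ∀ (S : Set ℝ) (γ : ℝ → G), S.OrdConnected → S.Nontrivial → (0 : ℝ) ∈ S →
      IsGeodesicOn I g γ S →
      (⟨γ 0, mfderivWithin 𝓘(ℝ, ℝ) I γ S 0 (1 : ℝ)⟩ : TangentBundle I G) = ⟨1, p₀ + q₀⟩ →
      ∀ t ∈ S, γ t = c t ∧
        leftTranslate I (γ t) (mfderivWithin 𝓘(ℝ, ℝ) I γ S t (1 : ℝ))
          = p₀ + adjointAction I (lieExp I ((δ * t) • p₀)) q₀ := by
  intro 𝔥 g c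
  have hcomplete : CompleteSpace E := FiniteDimensional.complete ℝ E
  -- the projection, the two forms and the derivative of `ι`, on the model spaces
  let P : E →L[ℝ] E := LinearMap.toContinuousLinearMap (B.proj 𝔥 : E →ₗ[ℝ] E)
  let Q : E →L[ℝ] E →L[ℝ] ℝ :=
    LinearMap.toContinuousBilinearMap (B.form : E →ₗ[ℝ] E →ₗ[ℝ] ℝ)
  let β : E →L[ℝ] E →L[ℝ] ℝ :=
    LinearMap.toContinuousBilinearMap (B.cheegerForm 𝔥 δ : E →ₗ[ℝ] E →ₗ[ℝ] ℝ)
  let D : F →L[ℝ] E := mfderiv J I ι 1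
  have hD : HasMFDerivAt J I ι (1 : K) D :=
    (himm.contMDiff.mdifferentiable (by simp) 1).hasMFDerivAt
  have hι : Continuous ι := himm.contMDiff.continuous
  -- the algebraic properties of the bracket, the metric and the projection
  have hQ0 : ∀ u, Q u u = 0 → u = 0 := fun u hu => by
    by_contra h
    exact (B.pos u h).ne' hu
  have hinv : ∀ u v w, Q (bracketCLM I G u v) w + Q v (bracketCLM I G u w) = 0 :=
    fun u v w => by
      have hbr : ∀ u v : GroupLieAlgebra I G, ⁅u, v⁆ = bracketCLM I G u v := lie_eq_bracketCLM
      have h := B.adInvariant u v w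
      rw [hbr u v, hbr u w] at h
      exact h
  have hP : ∀ u v, Q (P u) v = Q u (P v) := B.form_proj_left 𝔥
  have hPP : ∀ u, P (P u) = P u := B.proj_proj 𝔥
  have hPL : ∀ u v, P (bracketCLM I G (P u) (P v)) = bracketCLM I G (P u) (P v) := by
    intro u v
    obtain ⟨a, ha⟩ : ∃ a : F, D a = P u := B.proj_mem 𝔥 u
    obtain ⟨b, hb⟩ : ∃ b : F, D b = P v := B.proj_mem 𝔥 v
    rw [← ha, ← hb, bracketCLM_map hι hD]
    exact B.proj_of_mem 𝔥 ⟨bracketCLM J K a b, rfl⟩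
  have hPL' : ∀ u v, P (bracketCLM I G (P u) v) = bracketCLM I G (P u) (P v) :=
    proj_bracket_proj hQ0 hinv hP hPP hPL
  have hβ : ∀ u v, β u v = Q u v + δ * Q (P u) (P v) := fun u v => rfl
  have hβs : ∀ u v, β u v = β v u := fun u v => by
    have hQs : ∀ u v, Q u v = Q v u := B.symm
    rw [hβ, hβ, hQs u v, hQs (P u)]
  -- the geodesic equation, as an equation for the velocity
  have hEA := eulerArnold_cheeger_iff bracketCLM_swap bracketCLM_self hQ0 hinv hP hPP hPL
    (by linarith : 1 + δ ≠ 0) hβ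
  have hgeod : ∀ {γ : ℝ → G} {S : Set ℝ} (_ : UniqueDiffOn ℝ S) {u : ℝ → E}
      (_ : ∀ s ∈ S, HasLogDerivWithinAt I γ (ContinuousLinearMap.toSpanSingleton ℝ (u s)) S s),
      IsGeodesicOn I g γ S ↔ ContMDiffOn 𝓘(ℝ, ℝ) I 2 γ S ∧ ∀ t ∈ S,
        HasDerivWithinAt u (δ • bracketCLM I G (P (u t)) (u t)) S t := by
    intro γ S hS u hu
    rw [isGeodesicOn_leftInvariantMetric_iff (b := B.cheegerForm 𝔥 δ) (fun _ _ => rfl) hβs hS hu]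
    simp only [hEA, exists_eq_right]
  -- the initial velocity, in the model space
  let p : E := p₀
  let q : E := q₀
  have hp₀ : P p = p := B.proj_of_mem 𝔥 hp
  have hq₀ : P q = 0 := B.proj_of_mem_perp 𝔥 hq
  have hu₀ : P (p + q) = p := by rw [map_add, hp₀, hq₀, add_zero]
  -- the curve `c` and its velocity `z`
  have hc : c = fun t => expCurve I G (p + q + δ • p) t * expCurve I G p (-(δ * t)) := by
    funext t
    have h1 : (B.Lam 𝔥 δ (p₀ + q₀) : E) = p + q + δ • p := by
      change p + q + δ • P (p + q) = _
      rw [hu₀]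
    rw [← h1]
    rfl
  let z : ℝ → E := fun t => adjointCLM I (expCurve I G p (δ * t)) (p + q)
  have hclog : ∀ t,
      HasLogDerivWithinAt I c (ContinuousLinearMap.toSpanSingleton ℝ (z t)) univ t := by
    rw [hc]
    exact hasLogDerivWithinAt_expCurve_mul (p + q) p δ
  have hz : ∀ t, HasDerivAt z (δ • bracketCLM I G p (z t)) t :=
    hasDerivAt_adjointCLM_expCurve_mul p (p + q) δ
  have hz0 : z 0 = p + q := by
    simp only [z, mul_zero, expCurve_zero, adjointCLM_one, ContinuousLinearMap.id_apply]
  have hPz : ∀ t, P (z t) = p := fun t =>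
    proj_eq_of_hasDerivWithinAt_bracket bracketCLM_self hPL' convex_univ (mem_univ (0 : ℝ)) hp₀
      (fun s _ => (hz s).hasDerivWithinAt) (by rw [hz0, hu₀]) t (mem_univ t)
  have hc0 : c 0 = 1 := by simp [hc, expCurve_zero]
  have hcC : ContMDiff 𝓘(ℝ, ℝ) I 2 c := by
    rw [hc]
    have h1 : ContMDiff 𝓘(ℝ, ℝ) 𝓘(ℝ, ℝ) 2 (fun t : ℝ => -(δ * t)) :=
      contMDiff_iff_contDiff.2 (contDiff_const.mul contDiff_id).neg
    exact (contMDiff_expCurve _).mul ((contMDiff_expCurve _).comp h1)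
  refine ⟨⟨?_, ?_⟩, ?_⟩
  · rw [hgeod uniqueDiffOn_univ fun t _ => hclog t]
    refine ⟨hcC.contMDiffOn, fun t _ => ?_⟩
    rw [hPz]
    exact (hz t).hasDerivWithinAt
  · rw [tangentBundle_mk_eq_one_iff]
    refine ⟨hc0, ?_⟩
    have h1 := leftTranslate_mfderivWithin
      (hcC.mdifferentiable (by simp) 0).mdifferentiableWithinAt (hclog 0) uniqueDiffWithinAt_univ (1 : ℝ)
    rw [mfderivWithin_univ] at h1
    refine h1.trans ?_
    rw [ContinuousLinearMap.toSpanSingleton_apply, one_smul, hz0]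
    rfl
  · intro S γ hS hS' h0S hγ hγ0 t ht
    have hconv : Convex ℝ S := hS.convex
    have hUD : UniqueDiffOn ℝ S := by
      refine uniqueDiffOn_convex hconv ?_
      obtain ⟨a, ha, b, hb, hab⟩ := hS'.exists_lt
      obtain ⟨m, hm⟩ := nonempty_Ioo.2 hab
      exact ⟨m, interior_maximal (Ioo_subset_Icc_self.trans (hS.out ha hb)) isOpen_Ioo hm⟩
    obtain ⟨u, hu⟩ := exists_velocity hγ.1
    -- the geodesic and `c` have the same velocity, since both velocities solve `z' = δ [p, z]`
    have hγu := ((hgeod hUD hu).1 hγ).2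
    have hvel : ∀ s ∈ S, leftTranslate I (γ s) (mfderivWithin 𝓘(ℝ, ℝ) I γ S s (1 : ℝ)) = u s := by
      intro s hs
      refine (leftTranslate_mfderivWithin ((hγ.1 s hs).mdifferentiableWithinAt (by simp)) (hu s hs)
        (hUD s hs) (1 : ℝ)).trans ?_
      rw [ContinuousLinearMap.toSpanSingleton_apply, one_smul]
    rw [tangentBundle_mk_eq_one_iff, hvel 0 h0S] at hγ0
    obtain ⟨hγ1, hu0⟩ := hγ0
    have huz : EqOn u z S := eqOn_of_hasDerivWithinAt_bracket_proj bracketCLM_self hPL' hconv h0S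
      hγu (fun s _ => (hz s).hasDerivWithinAt) (hu0.trans hz0.symm) ((congrArg P hu0).trans hu₀)
    refine ⟨?_, ?_⟩
    · refine eqOn_of_hasLogDerivWithinAt (I := I)
        (A := fun s => ContinuousLinearMap.toSpanSingleton ℝ (z s)) hconv (fun s hs => ?_)
        (fun s _ => (hclog s).mono (subset_univ S)) h0S (hγ1.trans hc0.symm) ht
      rw [← huz hs]
      exact hu s hs
    · rw [hvel t ht, huz ht]
      change adjointCLM I (expCurve I G p (δ * t)) (p + q)
        = p + adjointCLM I (expCurve I G p (δ * t)) q
      rw [map_add, adjointCLM_expCurve_self]
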